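/- Let $L>0$, $n_+>1$, $\rho>0$. Let $\mathcal A_{sym}$ be the set of measurable $n:\mathbb R\to\mathbb R$ with $1\le n\le n_+$ on $[0,L]$, $n=1$ outside $[0,L]$ and $n(L-x)=n(x)$. A pair $(\omega,u)$, $\omega\in\mathbb C$, is a scattering resonance pair of $n$ if $u\not\equiv0$ is a locally integrable function on $\mathbb R$ with $$u(x)=\omega^2\int_0^L G(|x-y|,\omega)\,[n^2(y)-1]\,u(y)\,dy\quad(x\in\mathbb R),\qquad G(r,\omega)=-\frac{e^{i\omega r}}{2i\omega},$$ and then $\omega$ is called a resonance of $n$ (there is no such pair with $\omega=0$). Put $\Gamma^\rho[n]=\inf|\Im\omega|$, the infimum over all resonances $\omega$ of $n$ with $|\Re\omega|\le\rho$ ($\infty$ if there are none). Let $n_\star\in\mathcal A_{sym}$ be a local minimizer of $\Gamma^\rho$ over $\mathcal A_{sym}$ with respect to the $L^\infty$ distance, and let $(\omega_\star,u_\star)$ be a scattering resonance pair of $n_\star$ with $|\Im\omega_\star|=\Gamma^\rho[n_\star]$ and $0<|\Re\omega_\star|<\rho$. Then $u_\star(0)\neq0$, and $n_\star$ is (almost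 everywhere) a step function: there are an odd $N$ and points $0\le x_0<x_1<\dots<x_N\le L$ such that $n_\star=n_+$ a.e. on $(x_j,x_{j+1})$ for even $j<N$ and $n_\star=1$ a.e. elsewhere. For any such representation and every interior interval $I_j=[x_j,x_{j+1}]$, that is, $0<j<N-1$ and $j\ne(N-1)/2$, the minimum of $|u_\star|^2$ on $I_j$ exists and $$|x_{j+1}-x_j|\ \ge\ \frac{\min_{x\in I_j}|u_\star(x)|^2}{|u_\star(0)|^2}\;\frac14\;\frac{2\pi}{|\Re\omega_\star|}.$$ -/

import Mathlib

open MeasureTheory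

namespace Resonance1D

noncomputable section

/-- Admissible refractive indices on `[0, L]` with material bounds `nm ≤ n ≤ np`, equal to `1`
outside `[0, L]` and symmetric about `L / 2`. -/
def AdmissibleSym (L nm np : ℝ) : Set (ℝ → ℝ) :=
  {n | Measurable n ∧ (∀ x ∈ Set.Icc 0 L, nm ≤ n x ∧ n x ≤ np) ∧
    (∀ x, x ∉ Set.Icc 0 L → n x = 1) ∧ ∀ x, n (L - x) = n x}

/-- The outgoing free-space Green's function in dimension one, as a function of `r = |x - y|`. -/
def green (ω : ℂ) (r : ℝ) : ℂ :=
  -(2 * Complex.I * ω)⁻¹ * Complex.exp (Complex.I * ω * r)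

/-- `(ω, u)` is a scattering resonance pair for the index `n` on `[0, L]`: `u` is a nontrivial
locally integrable solution of the integral equation
`u(x) = ω² ∫_{[0,L]} G(|x - y|, ω) (n(y)² - 1) u(y) dy`.
The equation is imposed for every `x`, which selects the continuous representative of `u`. -/
structure IsResonancePair (L : ℝ) (n : ℝ → ℝ) (ω : ℂ) (u : ℝ → ℂ) : Prop where
  locallyIntegrable : LocallyIntegrable u volume
  nontrivial : u ≠ 0
  eq : ∀ x, u x = ω ^ 2 *
    ∫ y in Set.Icc 0 L, green ω |x - y| * ((n y : ℂ) ^ 2 - 1) * u y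

/-- The scattering resonances `ω` of `n` with `|Re ω| ≤ ρ`. -/
def Res (L ρ : ℝ) (n : ℝ → ℝ) : Set ℂ :=
  {ω | (∃ u, IsResonancePair L n ω u) ∧ |ω.re| ≤ ρ}

/-- The minimal resonance width, the infimum of `|Im ω|` over `Res L ρ n`
(`∞` if there is no such resonance). -/
def width (L ρ : ℝ) (n : ℝ → ℝ) : ENNReal :=
  ⨅ ω ∈ Res L ρ n, ENNReal.ofReal |ω.im|

/-- `n` is a local minimizer of the minimal resonance width over the symmetric admissible
structures, with respect to the `L^∞` distance. -/
def IsLocalMinimizer (L nm np ρ : ℝ) (n : ℝ → ℝ) : Prop :=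
  n ∈ AdmissibleSym L nm np ∧ ∃ ε : ℝ, 0 < ε ∧ ∀ m ∈ AdmissibleSym L nm np,
    eLpNorm (fun x => m x - n x) ⊤ volume < ENNReal.ofReal ε → width L ρ n ≤ width L ρ m

open Classical in
/-- The step function equal to `np` on the intervals `(x_j, x_{j+1})` with `j < N` even and
equal to `1` elsewhere. -/
def stepIndex (np : ℝ) (N : ℕ) (x : ℕ → ℝ) (y : ℝ) : ℝ :=
  if ∃ j, j < N ∧ Even j ∧ y ∈ Set.Ioo (x j) (x (j + 1)) then np else 1

/-- `x_0 < x_1 < ⋯ < x_N` in `[0, L]` are the discontinuity points of the step function `n`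
(up to null sets), which equals `np` on `(x_j, x_{j+1})` for even `j` and `1` otherwise.
`N` is odd, since the last point `x_N` is the right end of an interval on which `n = np`.
Only the values `x j` with `j ≤ N` matter. -/
structure IsTransitionSeq (L np : ℝ) (n : ℝ → ℝ) (N : ℕ) (x : ℕ → ℝ) : Prop where
  odd : Odd N
  strictMono : StrictMonoOn x (Set.Iic N)
  mem : ∀ j ≤ N, x j ∈ Set.Icc 0 L
  ae_eq : n =ᵐ[volume] stepIndex np N x

/-- `[x_j, x_{j+1}]` is an interior interval: neither the left-most one (`j = 0`), nor the
right-most one (`j = N - 1`), nor the center one (`j = (N - 1) / 2`). -/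
def IsInterior (N j : ℕ) : Prop :=
  0 < j ∧ j + 1 < N ∧ 2 * j + 1 ≠ N

end

end Resonance1D

/-!
The resonances of `n` are the zeros of the characteristic function `F(·, n²)`, the defect at `L` of
the outgoing condition for the solution which is outgoing at `0`. It is entire in the frequency and
smooth in `n²`, and its derivative in a direction `δ` of `n²` is a multiple of `∫ δ u²`. When `n²`
moves towards `n₁²`, the zero `ω`, of order `m` say, splits like the `m`-th roots of a multiple of
`∫ (n₁² - n²) u²`. Near `ω`, for a suitable constant `a ≠ 0`, some zero would move up if
`∫ (n₁² - n²) Im (a u²)` were positive; by local minimality this never happens, so that `n = n₊`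
where `Im (a u²) > 0` and `n = 1` where `Im (a u²) < 0`. The zeros of `Im (a u²)` are isolated,
hence `n` is a step function.

At the interior jumps `Im (a u²) = 0`, so between two successive ones the phase of `u` turns by at
least `π / 2`, as long as the energy flux `Im (ū u')` keeps its sign; by symmetry the flux vanishes
only at `L / 2`. The derivative of the phase is the flux divided by `|u|²`, and the flux is at most
`|Re ω| |u(0)|²`.
-/

namespace Resonance1D

open Set Filter Topology ComplexConjugate
open scoped Finset

/-- `F` is an indefinite integral of the locally integrable function `f`: the weak formulation of
`F' = f` for a coefficient that need not be continuous. -/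
structure IsPrimitive {E : Type*} [NormedAddCommGroup E] [NormedSpace ℝ E] (F f : ℝ → E) :
    Prop where
  intervalIntegrable : ∀ a b, IntervalIntegrable f volume a b
  sub_eq : ∀ a b, F b - F a = ∫ x in a..b, f x

namespace IsPrimitive

section NormedSpace

variable {E E' : Type*} [NormedAddCommGroup E] [NormedSpace ℝ E] [NormedAddCommGroup E']
  [NormedSpace ℝ E'] {F G f g : ℝ → E}

theorem locallyIntegrable (h : IsPrimitive F f) : LocallyIntegrable f volume := fun x =>
  ⟨Ioc (x - 1) (x + 1), Ioc_mem_nhds (by linarith) (by linarith),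
    (intervalIntegrable_iff_integrableOn_Ioc_of_le (by linarith)).1 (h.intervalIntegrable _ _)⟩

theorem eq_add (h : IsPrimitive F f) (a x : ℝ) : F x = F a + ∫ y in a..x, f y := by
  rw [← h.sub_eq a x, add_sub_cancel]

theorem integral (hf : ∀ a b, IntervalIntegrable f volume a b) (c : ℝ) :
    IsPrimitive (fun x => ∫ y in c..x, f y) f :=
  ⟨hf, fun _ _ => intervalIntegral.integral_interval_sub_left (hf _ _) (hf _ _)⟩

theorem congr (h : IsPrimitive F f) (hF : ∀ x, G x = F x) (hf : ∀ x, g x = f x) :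
    IsPrimitive G g := by
  rwa [funext hF, funext hf]

theorem add (hF : IsPrimitive F f) (hG : IsPrimitive G g) :
    IsPrimitive (fun x => F x + G x) (fun x => f x + g x) :=
  ⟨fun a b => (hF.intervalIntegrable a b).add (hG.intervalIntegrable a b), fun a b => by
    rw [intervalIntegral.integral_add (hF.intervalIntegrable a b) (hG.intervalIntegrable a b),
      ← hF.sub_eq, ← hG.sub_eq, add_sub_add_comm]⟩

theorem const_add (hF : IsPrimitive F f) (c : E) : IsPrimitive (fun x => c + F x) f :=
  ⟨hF.intervalIntegrable, fun a b => by rw [add_sub_add_left_eq_sub, hF.sub_eq]⟩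

theorem comp_const_sub (hF : IsPrimitive F f) (c : ℝ) :
    IsPrimitive (fun x => F (c - x)) (fun x => -f (c - x)) := by
  refine ⟨fun a b => ?_, fun a b => ?_⟩
  · have hf := (hF.intervalIntegrable (c - a) (c - b)).comp_sub_left c
    rw [sub_sub_cancel, sub_sub_cancel] at hf
    exact hf.neg
  · rw [intervalIntegral.integral_neg, intervalIntegral.integral_comp_sub_left, ← hF.sub_eq,
      neg_sub]

theorem of_forall_eq_integral (h : IsPrimitive F f) (a : ℝ) :
    F = fun x => F a + ∫ y in a..x, f y :=
  funext (h.eq_add a)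

theorem continuous (h : IsPrimitive F f) : Continuous F := by
  rw [h.of_forall_eq_integral 0]
  exact continuous_const.add (intervalIntegral.continuous_primitive h.intervalIntegrable 0)

theorem sub (hF : IsPrimitive F f) (hG : IsPrimitive G g) :
    IsPrimitive (fun x => F x - G x) (fun x => f x - g x) :=
  ⟨fun a b => (hF.intervalIntegrable a b).sub (hG.intervalIntegrable a b), fun a b => by
    rw [intervalIntegral.integral_sub (hF.intervalIntegrable a b) (hG.intervalIntegrable a b),
      ← hF.sub_eq, ← hG.sub_eq, sub_sub_sub_comm]⟩

theorem absolutelyContinuousOnInterval (h : IsPrimitive F f) (a b : ℝ) :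
    AbsolutelyContinuousOnInterval F a b := by
  have hn : ∀ c d, IntervalIntegrable (fun x => ‖f x‖) volume c d :=
    fun c d => (h.intervalIntegrable c d).norm
  have hac := (hn a b).absolutelyContinuousOnInterval_intervalIntegral (c := a) left_mem_uIcc
  rw [absolutelyContinuousOnInterval_iff] at hac ⊢
  intro ε hε
  obtain ⟨δ, hδ, H⟩ := hac ε hε
  refine ⟨δ, hδ, fun I hI hlt => (Finset.sum_le_sum fun i _ => ?_).trans_lt (H I hI hlt)⟩
  rw [dist_comm, dist_comm (∫ v in a..(I.2 i).1, ‖f v‖), dist_eq_norm, h.sub_eq, Real.dist_eq,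
    intervalIntegral.integral_interval_sub_left (hn _ _) (hn _ _)]
  exact intervalIntegral.norm_integral_le_abs_integral_norm

theorem eq_zero_of_norm_le (h : IsPrimitive F f) {K : ℝ} (hK : ∀ x, ‖f x‖ ≤ K * ‖F x‖) {c : ℝ}
    (hc : F c = 0) (x : ℝ) : F x = 0 := by
  suffices hclopen : IsClopen {x | F x = 0} from
    (hclopen.eq_univ ⟨c, hc⟩).ge (mem_univ x)
  refine ⟨isClosed_eq h.continuous continuous_const, Metric.isOpen_iff.2 fun a ha => ?_⟩
  obtain ⟨r, hr, hKr⟩ : ∃ r > 0, |K| * r < 1 :=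
    ⟨(|K| + 1)⁻¹, by positivity, by
      rw [← div_eq_mul_inv, div_lt_one (by positivity)]; exact lt_add_one _⟩
  obtain ⟨m, hm, hmax⟩ := (isCompact_closedBall a r).exists_isMaxOn
    ⟨a, Metric.mem_closedBall_self hr.le⟩ h.continuous.norm.continuousOn
  have hfm : ‖F m‖ ≤ |K| * r * ‖F m‖ := calc
    ‖F m‖ = ‖∫ y in a..m, f y‖ := by rw [← h.sub_eq a m, show F a = 0 from ha, sub_zero]
    _ ≤ |K| * ‖F m‖ * |m - a| := intervalIntegral.norm_integral_le_of_norm_le_const fun y hy => by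
      have hya : y ∈ Metric.closedBall a r := by
        rw [mem_closedBall_iff_norm, Real.norm_eq_abs]
        exact (abs_sub_left_of_mem_uIcc (uIoc_subset_uIcc hy)).trans hm
      exact (hK y).trans (mul_le_mul (le_abs_self K) (hmax hya) (norm_nonneg _) (abs_nonneg _))
    _ ≤ |K| * ‖F m‖ * r := by gcongr; exact hm
    _ = |K| * r * ‖F m‖ := by ring
  have hm0 : ‖F m‖ = 0 := by nlinarith [norm_nonneg (F m)]
  exact ⟨r, hr, fun y hy => norm_le_zero_iff.1
    ((hmax (Metric.ball_subset_closedBall hy)).trans hm0.le)⟩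

variable [CompleteSpace E] [CompleteSpace E']

theorem ae_hasDerivAt (h : IsPrimitive F f) : ∀ᵐ x, HasDerivAt F (f x) x := by
  rw [h.of_forall_eq_integral 0]
  filter_upwards [LocallyIntegrable.ae_hasDerivAt_integral h.locallyIntegrable] with x hx
  exact (hx 0).const_add _

theorem hasDerivAt (h : IsPrimitive F f) (hf : Continuous f) (x : ℝ) : HasDerivAt F (f x) x := by
  rw [h.of_forall_eq_integral 0]
  exact (hf.integral_hasStrictDerivAt 0 x).hasDerivAt.const_add _

theorem of_hasDerivAt (h : ∀ x, HasDerivAt F (f x) x) (hf : Continuous f) : IsPrimitive F f :=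
  ⟨hf.intervalIntegrable, fun a b => (intervalIntegral.integral_eq_sub_of_hasDerivAt
    (fun x _ => h x) (hf.intervalIntegrable a b)).symm⟩

theorem map (h : IsPrimitive F f) (T : E →L[ℝ] E') :
    IsPrimitive (fun x => T (F x)) (fun x => T (f x)) where
  intervalIntegrable a b :=
    ⟨T.integrable_comp (h.intervalIntegrable a b).1, T.integrable_comp (h.intervalIntegrable a b).2⟩
  sub_eq a b := by
    rw [T.intervalIntegral_comp_comm (h.intervalIntegrable a b), ← h.sub_eq, map_sub]

theorem prodMk {F' f' : ℝ → E'} (h : IsPrimitive F f) (h' : IsPrimitive F' f') :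
    IsPrimitive (fun x => (F x, F' x)) (fun x => (f x, f' x)) := by
  simpa using (h.map (.inl ℝ E E')).add (h'.map (.inr ℝ E E'))

end NormedSpace

section NormedAlgebra

variable {A : Type*} [NormedRing A] [NormedAlgebra ℝ A] [CompleteSpace A]
  {F G f g : ℝ → A}

theorem const_mul (hF : IsPrimitive F f) (c : A) :
    IsPrimitive (fun x => c * F x) (fun x => c * f x) :=
  hF.map (.mul ℝ A c)

theorem mul [NormMulClass A] (hF : IsPrimitive F f) (hG : IsPrimitive G g) :
    IsPrimitive (fun x => F x * G x) (fun x => f x * G x + F x * g x) := by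
  have hl : ∀ a b, IntervalIntegrable (fun x => f x * G x + F x * g x) volume a b := fun a b =>
    ((hF.intervalIntegrable a b).mul_continuousOn hG.continuous.continuousOn).add
      ((hG.intervalIntegrable a b).continuousOn_mul hF.continuous.continuousOn)
  have hP := IsPrimitive.integral hl 0
  refine ⟨hl, fun a b => ?_⟩
  have hac := ((hF.absolutelyContinuousOnInterval a b).smul
    (hG.absolutelyContinuousOnInterval a b)).sub (hP.absolutelyContinuousOnInterval a b)
  obtain ⟨C, hC⟩ := hac.const_of_ae_hasDerivAt_zero <| by
    filter_upwards [hF.ae_hasDerivAt, hG.ae_hasDerivAt, hP.ae_hasDerivAt] with x hFx hGx hPx _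
    exact ((hFx.mul hGx).sub hPx).congr_deriv (sub_self _)
  have ha : F a * G a - (∫ y in (0 : ℝ)..a, f y * G y + F y * g y) = C := hC a left_mem_uIcc
  have hb : F b * G b - (∫ y in (0 : ℝ)..b, f y * G y + F y * g y) = C := hC b right_mem_uIcc
  rw [← hP.sub_eq, sub_eq_sub_iff_sub_eq_sub, hb, ha]

end NormedAlgebra

end IsPrimitive

theorem isPrimitive_cexp (c : ℂ) :
    IsPrimitive (fun x : ℝ => Complex.exp (c * x)) (fun x : ℝ => c * Complex.exp (c * x)) := by
  refine .of_hasDerivAt (fun x => ?_) (by fun_prop)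
  simpa [mul_comm] using ((Complex.ofRealCLM.hasDerivAt (x := x)).const_mul c).cexp

/-- The square `n²` of a refractive index, as the complex coefficient of the Helmholtz equation. -/
def permittivity (n : ℝ → ℝ) (x : ℝ) : ℂ := (n x : ℂ) ^ 2

/-- `u' = w` and `w' = -ω² q u`: a weak solution `u` of the Helmholtz equation `u'' + ω² q u = 0`,
with its derivative `w` as explicit data. -/
structure SolvesHelmholtz (q : ℝ → ℂ) (ω : ℂ) (u w : ℝ → ℂ) : Prop where
  isPrimitive : IsPrimitive u w
  isPrimitive_deriv : IsPrimitive w (fun x => -ω ^ 2 * (q x * u x))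

namespace SolvesHelmholtz

section Uniqueness

variable {q : ℝ → ℂ} {ω : ℂ} {u w u₁ w₁ : ℝ → ℂ} {K : ℝ}

theorem continuous (h : SolvesHelmholtz q ω u w) : Continuous u :=
  h.isPrimitive.continuous

theorem hasDerivAt (h : SolvesHelmholtz q ω u w) (x : ℝ) : HasDerivAt u (w x) x :=
  h.isPrimitive.hasDerivAt h.isPrimitive_deriv.continuous x

theorem const_mul (h : SolvesHelmholtz q ω u w) (c : ℂ) :
    SolvesHelmholtz q ω (fun x => c * u x) (fun x => c * w x) :=
  ⟨h.isPrimitive.const_mul c, by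
    simpa only [mul_left_comm c] using h.isPrimitive_deriv.const_mul c⟩

theorem sub (h : SolvesHelmholtz q ω u w) (h₁ : SolvesHelmholtz q ω u₁ w₁) :
    SolvesHelmholtz q ω (fun x => u x - u₁ x) (fun x => w x - w₁ x) :=
  ⟨h.isPrimitive.sub h₁.isPrimitive, by
    simpa only [mul_sub] using h.isPrimitive_deriv.sub h₁.isPrimitive_deriv⟩

theorem reflect (h : SolvesHelmholtz q ω u w) {c : ℝ} (hq : ∀ x, q (c - x) = q x) :
    SolvesHelmholtz q ω (fun x => u (c - x)) (fun x => -w (c - x)) :=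
  ⟨h.isPrimitive.comp_const_sub c, by
    simpa only [hq, neg_neg, Pi.neg_apply, mul_neg_one, neg_mul, one_mul] using
      (h.isPrimitive_deriv.comp_const_sub c).const_mul (-1)⟩

theorem eq_zero (h : SolvesHelmholtz q ω u w) (hq : ∀ x, ‖q x‖ ≤ K) {c : ℝ} (hu : u c = 0)
    (hw : w c = 0) : u = 0 := by
  have hbound : ∀ x, ‖(w x, -ω ^ 2 * (q x * u x))‖ ≤ max 1 (‖ω‖ ^ 2 * K) * ‖(u x, w x)‖ := by
    intro x
    refine norm_prod_le_iff.2 ⟨?_, ?_⟩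
    · calc ‖w x‖ ≤ 1 * ‖(u x, w x)‖ := by rw [one_mul]; exact norm_snd_le (u x, w x)
        _ ≤ _ := by gcongr; exact le_max_left _ _
    · calc ‖-ω ^ 2 * (q x * u x)‖ = ‖ω‖ ^ 2 * ‖q x‖ * ‖u x‖ := by
            rw [norm_mul, norm_neg, norm_pow, norm_mul, mul_assoc]
        _ ≤ ‖ω‖ ^ 2 * K * ‖(u x, w x)‖ := by
            gcongr
            exacts [mul_nonneg (sq_nonneg _) ((norm_nonneg _).trans (hq x)), hq x,
              norm_fst_le (u x, w x)]
        _ ≤ _ := by gcongr; exact le_max_right _ _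
  have hz := (h.isPrimitive.prodMk h.isPrimitive_deriv).eq_zero_of_norm_le hbound
    (Prod.mk_eq_zero.2 ⟨hu, hw⟩)
  exact funext fun x => congrArg Prod.fst (hz x)

theorem eq_of_eq (h : SolvesHelmholtz q ω u w) (h₁ : SolvesHelmholtz q ω u₁ w₁)
    (hq : ∀ x, ‖q x‖ ≤ K) {c : ℝ} (hu : u c = u₁ c) (hw : w c = w₁ c) : u = u₁ :=
  funext fun x => sub_eq_zero.1
    (congrFun ((h.sub h₁).eq_zero hq (sub_eq_zero.2 hu) (sub_eq_zero.2 hw)) x)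

end Uniqueness

end SolvesHelmholtz

/-- The energy flux `Im (ū u')` of a function `u` with derivative `w`. -/
def flux (u w : ℝ → ℂ) (x : ℝ) : ℝ := (conj (u x) * w x).im

namespace SolvesHelmholtz

variable {n : ℝ → ℝ} {ω : ℂ} {u w : ℝ → ℂ} {K : ℝ}

theorem flux_sub (h : SolvesHelmholtz (permittivity n) ω u w) (a b : ℝ) :
    flux u w b - flux u w a = -(ω ^ 2).im * ∫ x in a..b, n x ^ 2 * ‖u x‖ ^ 2 := by
  have hconj := h.isPrimitive.map (Complex.conjCLE : ℂ →L[ℝ] ℂ)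
  rw [← intervalIntegral.integral_const_mul]
  refine (((hconj.mul h.isPrimitive_deriv).map Complex.imCLM).sub_eq a b).trans
    (intervalIntegral.integral_congr fun x _ => ?_)
  have hderiv : conj (w x) * w x + conj (u x) * (-ω ^ 2 * (permittivity n x * u x)) =
      ((‖w x‖ ^ 2 : ℝ) : ℂ) - ((n x ^ 2 * ‖u x‖ ^ 2 : ℝ) : ℂ) * ω ^ 2 := by
    push_cast
    rw [← Complex.conj_mul', ← Complex.conj_mul', permittivity]
    ring
  have him := congrArg Complex.im hderiv
  rw [Complex.sub_im, Complex.ofReal_im, Complex.im_ofReal_mul] at him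
  exact him.trans (by ring)

theorem energy_pos (h : SolvesHelmholtz (permittivity n) ω u w) (hω : ω ≠ 0)
    (hn : ∀ x, n x ≠ 0) (hK : ∀ x, ‖permittivity n x‖ ≤ K) (hu : u ≠ 0) {a b : ℝ} (hab : a < b) :
    0 < ∫ x in a..b, n x ^ 2 * ‖u x‖ ^ 2 := by
  have hint : IntervalIntegrable (fun x => n x ^ 2 * ‖u x‖ ^ 2) volume a b := by
    have hi := ((h.isPrimitive_deriv.intervalIntegrable a b).const_mul
      (-ω ^ 2)⁻¹).mul_continuousOn (h.continuous.star).continuousOn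
    have hi' : IntervalIntegrable (fun x => ((n x ^ 2 * ‖u x‖ ^ 2 : ℝ) : ℂ)) volume a b := by
      refine hi.congr fun x _ => ?_
      have : -ω ^ 2 ≠ 0 := by simpa using hω
      simp only [permittivity, Complex.star_def]
      push_cast
      rw [inv_mul_cancel_left₀ this, ← Complex.mul_conj']
      ring
    exact ⟨hi'.1.re, hi'.2.re⟩
  have hsupp : Function.support (fun x => n x ^ 2 * ‖u x‖ ^ 2) = {x | u x ≠ 0} := by
    ext x; simp [hn x]
  obtain ⟨c, hc, huc⟩ : ∃ c ∈ Ioo a b, u c ≠ 0 := by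
    by_contra! hz
    have hc : (a + b) / 2 ∈ Ioo a b := ⟨by linarith, by linarith⟩
    have hev : u =ᶠ[𝓝 ((a + b) / 2)] fun _ => 0 :=
      Filter.mem_of_superset (isOpen_Ioo.mem_nhds hc) hz
    exact hu (h.eq_zero hK (hz _ hc)
      ((h.hasDerivAt _).unique ((hasDerivAt_const _ 0).congr_of_eventuallyEq hev)))
  rw [intervalIntegral.integral_pos_iff_support_of_nonneg_ae
    (Eventually.of_forall fun x => by positivity) hint, hsupp]
  have hopen : IsOpen ({x | u x ≠ 0} ∩ Ioo a b) :=
    (isOpen_ne_fun h.continuous continuous_const).inter isOpen_Ioo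
  exact ⟨hab, (hopen.measure_pos volume ⟨c, huc, hc⟩).trans_le
    (measure_mono (inter_subset_inter_right _ Ioo_subset_Ioc_self))⟩

end SolvesHelmholtz

theorem integral_mul_ne_zero {r P : ℝ → ℝ} {a b : ℝ} (hab : a < b) (hP : ContinuousOn P (Ioo a b))
    (hint : IntervalIntegrable (fun x => r x * P x) volume a b) (hr : ∀ x ∈ Ioo a b, 0 < r x)
    (hne : ∀ x ∈ Ioo a b, P x ≠ 0) : ∫ x in a..b, r x * P x ≠ 0 := by
  have hsign : (∀ x ∈ Ioo a b, 0 < P x) ∨ ∀ x ∈ Ioo a b, P x < 0 := by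
    by_contra! h
    obtain ⟨⟨x, hx, hPx⟩, y, hy, hPy⟩ := h
    obtain ⟨z, hz, hz0⟩ := isPreconnected_Ioo.intermediate_value hx hy hP ⟨hPx, hPy⟩
    exact hne z hz hz0
  rcases hsign with h | h
  · exact (intervalIntegral.intervalIntegral_pos_of_pos_on hint
      (fun x hx => mul_pos (hr x hx) (h x hx)) hab).ne'
  · have hpos := intervalIntegral.intervalIntegral_pos_of_pos_on hint.neg
      (fun x hx => neg_pos.2 (mul_neg_of_pos_of_neg (hr x hx) (h x hx))) hab
    exact fun h0 => hpos.ne' (by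
      simp only [Pi.neg_apply, intervalIntegral.integral_neg, h0, neg_zero])

section IsolatedZeros

theorem eventually_nhdsNE_ne_zero {f : ℝ → ℝ} {f' c : ℝ} (hf : HasDerivAt f f' c)
    (h : f c ≠ 0 ∨ f' ≠ 0) : ∀ᶠ x in 𝓝[≠] c, f x ≠ 0 :=
  h.elim (fun h => (hf.continuousAt.eventually_ne h).filter_mono nhdsWithin_le_nhds)
    fun h => hf.eventually_ne h

/-- By Rolle's theorem a zero of `v` near the double zero `c` would give a zero of `v'` near `c`,
while `v'` is strictly monotone on each side of `c`. -/
theorem eventually_nhdsNE_ne_zero_of_isPrimitive {v v' r P : ℝ → ℝ} {c : ℝ}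
    (hv : ∀ x, HasDerivAt v (v' x) x) (hv' : IsPrimitive v' (fun x => r x * P x))
    (hr : ∀ x, 0 < r x) (hP : Continuous P) (hPc : ∀ᶠ x in 𝓝[≠] c, P x ≠ 0) (hvc : v c = 0)
    (hvc' : v' c = 0) : ∀ᶠ x in 𝓝[≠] c, v x ≠ 0 := by
  have hv'ne : ∀ a b, a < b → (∀ x ∈ Ioo a b, P x ≠ 0) → v' a ≠ v' b := fun a b hab hne h =>
    integral_mul_ne_zero hab hP.continuousOn (hv'.intervalIntegrable a b) (fun x _ => hr x) hne
      (by rw [← hv'.sub_eq, h, sub_self])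
  have hrolle : ∀ a b, a < b → v a = 0 → v b = 0 → ∃ ξ ∈ Ioo a b, v' ξ = 0 := fun a b hab ha hb =>
    exists_hasDerivAt_eq_zero hab (HasDerivAt.continuousOn fun x _ => hv x) (ha.trans hb.symm)
      fun x _ => hv x
  rw [← nhdsLT_sup_nhdsGT, eventually_sup] at hPc ⊢
  obtain ⟨⟨l, hl, hPl⟩, r, hr, hPr⟩ := And.intro
    ((mem_nhdsLT_iff_exists_Ioo_subset).1 hPc.1) ((mem_nhdsGT_iff_exists_Ioo_subset).1 hPc.2)
  constructor
  · filter_upwards [Ioo_mem_nhdsLT hl] with x hx hvx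
    obtain ⟨ξ, hξ, hvξ⟩ := hrolle x c hx.2 hvx hvc
    exact hv'ne ξ c hξ.2 (fun y hy => hPl ⟨hx.1.trans (hξ.1.trans hy.1), hy.2⟩)
      (hvξ.trans hvc'.symm)
  · filter_upwards [Ioo_mem_nhdsGT hr] with x hx hvx
    obtain ⟨ξ, hξ, hvξ⟩ := hrolle c x hx.1 hvc hvx
    exact hv'ne c ξ hξ.1 (fun y hy => hPr ⟨hy.1, hy.2.trans (hξ.2.trans hx.2)⟩)
      (hvc'.trans hvξ.symm)

namespace SolvesHelmholtz

variable {n : ℝ → ℝ} {ω : ℂ} {u w : ℝ → ℂ} {K : ℝ}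

theorem eventually_im_ne_zero (h : SolvesHelmholtz (permittivity n) ω u w) (hω : (ω ^ 2).im ≠ 0)
    (hn : ∀ x, n x ≠ 0) {c : ℝ} (hc : ¬(u c = 0 ∧ w c = 0)) :
    ∀ᶠ x in 𝓝[≠] c, (u x).im ≠ 0 := by
  have hd : ∀ x, HasDerivAt (fun x => (u x).im) (w x).im x := fun x =>
    Complex.imCLM.hasFDerivAt.comp_hasDerivAt x (h.hasDerivAt x)
  by_cases hnd : (u c).im ≠ 0 ∨ (w c).im ≠ 0
  · exact eventually_nhdsNE_ne_zero (hd c) hnd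
  obtain ⟨hu, hw⟩ : (u c).im = 0 ∧ (w c).im = 0 := by simpa only [not_or, not_not] using hnd
  have hdP : HasDerivAt (fun x => (-ω ^ 2 * u x).im) (-ω ^ 2 * w c).im c :=
    Complex.imCLM.hasFDerivAt.comp_hasDerivAt c ((h.hasDerivAt c).const_mul _)
  have hreal : ∀ z : ℂ, z.im = 0 → z ≠ 0 → (-ω ^ 2 * z).im ≠ 0 := fun z hz hz0 => by
    rw [Complex.mul_im, hz, mul_zero, zero_add, Complex.neg_im, neg_mul]
    exact neg_ne_zero.2 (mul_ne_zero hω fun hre => hz0 (Complex.ext hre hz))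
  have hdd := h.isPrimitive_deriv.map Complex.imCLM
  refine eventually_nhdsNE_ne_zero_of_isPrimitive (r := fun x => n x ^ 2)
    (P := fun x => (-ω ^ 2 * u x).im) hd ?_ (fun x => by have := hn x; positivity)
    (Complex.continuous_im.comp (continuous_const.mul h.continuous))
    (eventually_nhdsNE_ne_zero hdP ?_) hu hw
  · have hsource : ∀ x, (-ω ^ 2 * (permittivity n x * u x)).im = n x ^ 2 * (-ω ^ 2 * u x).im := by
      intro x
      rw [permittivity, mul_left_comm, ← Complex.ofReal_pow, Complex.im_ofReal_mul]
    simpa only [Complex.imCLM_apply, hsource] using hdd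
  · by_cases hu0 : u c = 0
    · exact .inr (hreal _ hw fun hw0 => hc ⟨hu0, hw0⟩)
    · exact .inl (hreal _ hu hu0)

theorem finite_im_eq_zero (h : SolvesHelmholtz (permittivity n) ω u w) (hω : (ω ^ 2).im ≠ 0)
    (hn : ∀ x, n x ≠ 0) (hK : ∀ x, ‖permittivity n x‖ ≤ K) (hu : u ≠ 0) {s : Set ℝ}
    (hs : IsCompact s) : {x ∈ s | (u x).im = 0}.Finite := by
  by_contra hinf
  obtain ⟨c, -, hacc⟩ := Set.Infinite.exists_accPt_of_subset_isCompact hinf hs (sep_subset _ _)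
  rw [accPt_iff_frequently_nhdsNE] at hacc
  refine hacc ((h.eventually_im_ne_zero hω hn fun hc => hu (h.eq_zero hK hc.1 hc.2)).mono ?_)
  exact fun x hx hx' => hx hx'.2

theorem finite_im_mul_sq_eq_zero (h : SolvesHelmholtz (permittivity n) ω u w)
    (hω : (ω ^ 2).im ≠ 0) (hn : ∀ x, n x ≠ 0) (hK : ∀ x, ‖permittivity n x‖ ≤ K) (hu : u ≠ 0)
    {a : ℂ} (ha : a ≠ 0) {s : Set ℝ} (hs : IsCompact s) :
    {x ∈ s | (a * u x ^ 2).im = 0}.Finite := by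
  obtain ⟨b, rfl⟩ := IsAlgClosed.exists_pow_nat_eq a two_pos
  have hfin : ∀ c : ℂ, c ≠ 0 → {x ∈ s | (c * u x).im = 0}.Finite := fun c hc =>
    (h.const_mul c).finite_im_eq_zero hω hn hK
      (fun h0 => hu (funext fun x => (mul_eq_zero.1 (congrFun h0 x)).resolve_left hc)) hs
  have hb : b ≠ 0 := fun hb => ha (by rw [hb, zero_pow two_ne_zero])
  refine ((hfin b hb).union (hfin (Complex.I * b) (mul_ne_zero Complex.I_ne_zero hb))).subset ?_
  rintro x ⟨hx, hx0⟩
  rw [← mul_pow, sq, Complex.mul_im, mul_comm (b * u x).im, ← two_mul] at hx0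
  rcases mul_eq_zero.1 ((mul_eq_zero.1 hx0).resolve_left two_ne_zero) with hre | him
  · exact .inr ⟨hx, by rw [mul_assoc, Complex.I_mul_im, hre]⟩
  · exact .inl ⟨hx, him⟩

end SolvesHelmholtz

end IsolatedZeros

section Phase

theorem eq_mul_exp_integral_div {u w : ℝ → ℂ} {α β : ℝ} (hu : ∀ x, HasDerivAt u (w x) x)
    (hw : Continuous w) (hαβ : α ≤ β) (hne : ∀ x ∈ Icc α β, u x ≠ 0) :
    u β = u α * Complex.exp (∫ y in α..β, w y / u y) := by
  have huc : Continuous u := continuous_iff_continuousAt.2 fun x => (hu x).continuousAt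
  have hcont : ContinuousOn (fun x => w x / u x) (Icc α β) :=
    hw.continuousOn.div huc.continuousOn hne
  set f : ℝ → ℂ := fun x => ∫ y in α..x, w y / u y
  have hfd : ∀ x ∈ Icc α β, HasDerivAt f (w x / u x) x := fun x hx =>
    intervalIntegral.integral_hasDerivAt_right
      ((hcont.mono (Icc_subset_Icc_right hx.2)).intervalIntegrable_of_Icc hx.1)
      (hw.measurable.div huc.measurable).stronglyMeasurable.stronglyMeasurableAtFilter
      (hw.continuousAt.div huc.continuousAt (hne x hx))
  have hd : ∀ x ∈ Icc α β, HasDerivAt (fun x => u x * Complex.exp (-f x)) 0 x := fun x hx =>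
    ((hu x).mul (hfd x hx).neg.cexp).congr_deriv (by field_simp [hne x hx]; ring)
  have hconst := constant_of_has_deriv_right_zero (HasDerivAt.continuousOn hd)
    (fun x hx => (hd x (Ico_subset_Icc_self hx)).hasDerivWithinAt) β (right_mem_Icc.2 hαβ)
  have hfα : f α = 0 := intervalIntegral.integral_same
  simp only [hfα, neg_zero, Complex.exp_zero, mul_one] at hconst
  rw [← hconst, mul_assoc, ← Complex.exp_add, neg_add_cancel, Complex.exp_zero, mul_one]

theorem im_div_eq_flux_div (u w : ℝ → ℂ) (x : ℝ) : (w x / u x).im = flux u w x / ‖u x‖ ^ 2 := by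
  rw [div_eq_mul_inv, Complex.inv_def, ← mul_assoc, mul_comm (w x), Complex.im_mul_ofReal, flux,
    Complex.normSq_eq_norm_sq, div_eq_mul_inv]

theorem pi_le_two_mul_abs_im {z ζ : ℂ} (hz : z ≠ 0) (hz0 : z.im = 0)
    (h : (z * Complex.exp (2 * ζ)).im = 0) (hζ : ζ.im ≠ 0) : Real.pi ≤ 2 * |ζ.im| := by
  have hre : z.re ≠ 0 := fun hre => hz (Complex.ext hre hz0)
  have hsin : Real.sin (2 * ζ.im) = 0 := by
    rw [Complex.mul_im, hz0, zero_mul, add_zero, Complex.exp_im] at h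
    simpa [hre, (Real.exp_pos _).ne'] using h
  obtain ⟨k, hk⟩ := Real.sin_eq_zero_iff.1 hsin
  have hk0 : k ≠ 0 := by
    rintro rfl
    exact hζ (by simpa using hk.symm)
  have hk1 : (1 : ℝ) ≤ |(k : ℝ)| := by exact_mod_cast Int.one_le_abs hk0
  calc Real.pi ≤ |(k : ℝ)| * Real.pi := le_mul_of_one_le_left Real.pi_pos.le hk1
    _ = 2 * |ζ.im| := by
      rw [← abs_two (α := ℝ), ← abs_mul, ← hk, abs_mul, abs_of_pos Real.pi_pos]

theorem im_integral_div_eq {u w : ℝ → ℂ} {α β : ℝ}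
    (hint : IntervalIntegrable (fun x => w x / u x) volume α β) :
    (∫ y in α..β, w y / u y).im = ∫ y in α..β, (‖u y‖ ^ 2)⁻¹ * flux u w y := by
  simp only [← div_eq_inv_mul, ← im_div_eq_flux_div]
  exact (Complex.imCLM.intervalIntegral_comp_comm hint).symm

theorem abs_im_integral_div_le {u w : ℝ → ℂ} {α β C m : ℝ} (hαβ : α ≤ β)
    (hint : IntervalIntegrable (fun x => w x / u x) volume α β)
    (hC : ∀ x ∈ Icc α β, |flux u w x| ≤ C) (hm : 0 < m) (hmu : ∀ x ∈ Icc α β, m ≤ ‖u x‖ ^ 2) :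
    |(∫ y in α..β, w y / u y).im| ≤ m⁻¹ * C * (β - α) := by
  rw [im_integral_div_eq hint, ← Real.norm_eq_abs, ← abs_of_nonneg (sub_nonneg.2 hαβ)]
  refine intervalIntegral.norm_integral_le_of_norm_le_const fun x hx => ?_
  have hx' : x ∈ Icc α β := uIcc_of_le hαβ ▸ uIoc_subset_uIcc hx
  rw [norm_mul, norm_inv, norm_pow, norm_norm, Real.norm_eq_abs]
  exact mul_le_mul (inv_anti₀ hm (hmu x hx')) (hC x hx') (abs_nonneg _) (inv_nonneg.2 hm.le)

theorem pi_div_two_mul_le {u w : ℝ → ℂ} (hu : ∀ x, HasDerivAt u (w x) x) (hw : Continuous w)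
    {α β C m : ℝ} (hαβ : α < β) (hflux : ∀ x ∈ Icc α β, flux u w x ≠ 0)
    (hC : ∀ x ∈ Icc α β, |flux u w x| ≤ C) {a : ℂ} (ha : a ≠ 0)
    (hα : (a * u α ^ 2).im = 0) (hβ : (a * u β ^ 2).im = 0) (hm : 0 < m)
    (hmu : ∀ x ∈ Icc α β, m ≤ ‖u x‖ ^ 2) : Real.pi / 2 * m ≤ (β - α) * C := by
  have huc : Continuous u := continuous_iff_continuousAt.2 fun x => (hu x).continuousAt
  have hne : ∀ x ∈ Icc α β, u x ≠ 0 := fun x hx h0 => hflux x hx (by simp [flux, h0])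
  have hint : IntervalIntegrable (fun x => w x / u x) volume α β :=
    (hw.continuousOn.div huc.continuousOn hne).intervalIntegrable_of_Icc hαβ.le
  set θ : ℂ := ∫ y in α..β, w y / u y
  have hexp : a * u β ^ 2 = a * u α ^ 2 * Complex.exp (2 * θ) := by
    rw [eq_mul_exp_integral_div hu hw hαβ.le hne, mul_pow, ← Complex.exp_nat_mul, mul_assoc,
      Nat.cast_ofNat]
  have hθ0 : θ.im ≠ 0 := by
    rw [im_integral_div_eq hint]
    refine integral_mul_ne_zero hαβ
      ((Complex.continuous_im.comp ((Complex.continuous_conj.comp huc).mul hw)).continuousOn)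
      ?_ (fun x hx => ?_) fun x hx => hflux x (Ioo_subset_Icc_self hx)
    · simp only [← div_eq_inv_mul, ← im_div_eq_flux_div]
      exact ⟨hint.1.im, hint.2.im⟩
    · have := hne x (Ioo_subset_Icc_self hx)
      positivity
  have hpi : Real.pi ≤ 2 * |θ.im| :=
    pi_le_two_mul_abs_im (mul_ne_zero ha (pow_ne_zero 2 (hne α (left_mem_Icc.2 hαβ.le)))) hα
      (hexp ▸ hβ) hθ0
  have hbound := abs_im_integral_div_le hαβ.le hint hC hm hmu
  calc Real.pi / 2 * m ≤ m⁻¹ * C * (β - α) * m := by gcongr; linarith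
    _ = (β - α) * C := by field_simp

end Phase

/-- The field `ω² ∫₀ᴸ G(|x - y|, ω) f(y) dy` radiated by a source `f` supported in `[0, L]`, written
as the sum of the right-moving wave emitted on `[0, x]` and the left-moving wave emitted on
`[x, L]`. -/
noncomputable def greenPotential (L : ℝ) (ω : ℂ) (f : ℝ → ℂ) (x : ℝ) : ℂ :=
  Complex.I * ω / 2 *
    (Complex.exp (Complex.I * ω * x) *
        (∫ y in (0 : ℝ)..x, Complex.exp (-(Complex.I * ω) * y) * f y) +
      Complex.exp (-(Complex.I * ω) * x) * ∫ y in x..L, Complex.exp (Complex.I * ω * y) * f y)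

/-- The derivative of `greenPotential L ω f`. -/
noncomputable def greenPotentialDeriv (L : ℝ) (ω : ℂ) (f : ℝ → ℂ) (x : ℝ) : ℂ :=
  Complex.I * ω / 2 * (Complex.I * ω) *
    (Complex.exp (Complex.I * ω * x) *
        (∫ y in (0 : ℝ)..x, Complex.exp (-(Complex.I * ω) * y) * f y) -
      Complex.exp (-(Complex.I * ω) * x) * ∫ y in x..L, Complex.exp (Complex.I * ω * y) * f y)

section GreenPotential

variable {L : ℝ} {ω : ℂ} {f g : ℝ → ℂ}

theorem cexp_mul_cexp_neg (c : ℂ) : Complex.exp c * Complex.exp (-c) = 1 := by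
  rw [← Complex.exp_add, add_neg_cancel, Complex.exp_zero]

theorem intervalIntegrable_cexp_mul (c : ℂ) {a b : ℝ} (hf : IntervalIntegrable f volume a b) :
    IntervalIntegrable (fun y => Complex.exp (c * y) * f y) volume a b :=
  hf.continuousOn_mul (by fun_prop)

theorem integral_green_mul_left (hf : ∀ y < 0, f y = 0) (x : ℝ) :
    ∫ y in (0 : ℝ)..x, green ω |x - y| * f y = -(2 * Complex.I * ω)⁻¹ *
      (Complex.exp (Complex.I * ω * x) *
        ∫ y in (0 : ℝ)..x, Complex.exp (-(Complex.I * ω) * y) * f y) := by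
  simp only [← intervalIntegral.integral_const_mul]
  refine intervalIntegral.integral_congr_uIoo fun y hy => ?_
  rcases le_total 0 x with hx | hx
  · rw [uIoo_of_le hx] at hy
    simp only [green, abs_of_nonneg (sub_nonneg.2 hy.2.le)]
    rw [mul_assoc, ← mul_assoc (Complex.exp _), ← Complex.exp_add]
    push_cast
    ring_nf
  · rw [uIoo_of_ge hx] at hy
    simp only [hf y hy.2, mul_zero]

theorem integral_green_mul_right (hf : ∀ y, L < y → f y = 0) (x : ℝ) :
    ∫ y in x..L, green ω |x - y| * f y = -(2 * Complex.I * ω)⁻¹ *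
      (Complex.exp (-(Complex.I * ω) * x) *
        ∫ y in x..L, Complex.exp (Complex.I * ω * y) * f y) := by
  simp only [← intervalIntegral.integral_const_mul]
  refine intervalIntegral.integral_congr_uIoo fun y hy => ?_
  rcases le_total x L with hx | hx
  · rw [uIoo_of_le hx] at hy
    simp only [green, abs_of_nonpos (sub_nonpos.2 hy.1.le)]
    rw [mul_assoc, ← mul_assoc (Complex.exp _), ← Complex.exp_add]
    push_cast
    ring_nf
  · rw [uIoo_of_ge hx] at hy
    simp only [hf y hy.1, mul_zero]

theorem integral_green_mul_eq (hL : 0 ≤ L) (hω : ω ≠ 0)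
    (hf : ∀ a b, IntervalIntegrable f volume a b) (hsupp : ∀ x ∉ Icc 0 L, f x = 0) (x : ℝ) :
    ω ^ 2 * ∫ y in Icc 0 L, green ω |x - y| * f y = greenPotential L ω f x := by
  have hint : ∀ a b, IntervalIntegrable (fun y => green ω |x - y| * f y) volume a b := fun a b =>
    (hf a b).continuousOn_mul (by unfold green; fun_prop)
  have hcω : ω ^ 2 * -(2 * Complex.I * ω)⁻¹ = Complex.I * ω / 2 := by
    rw [mul_inv, mul_inv, Complex.inv_I]
    field_simp
  rw [integral_Icc_eq_integral_Ioc, ← intervalIntegral.integral_of_le hL,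
    ← intervalIntegral.integral_add_adjacent_intervals (hint 0 x) (hint x L),
    integral_green_mul_left (fun y hy => hsupp y fun h => hy.not_ge h.1),
    integral_green_mul_right (fun y hy => hsupp y fun h => hy.not_ge h.2),
    ← mul_add, ← mul_assoc, hcω, greenPotential]

theorem isPrimitive_greenPotential (hf : ∀ a b, IntervalIntegrable f volume a b) :
    IsPrimitive (greenPotential L ω f) (greenPotentialDeriv L ω f) ∧
      IsPrimitive (greenPotentialDeriv L ω f)
        (fun x => -ω ^ 2 * (greenPotential L ω f x + f x)) := by
  have hP := (isPrimitive_cexp (Complex.I * ω)).mul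
    (.integral (fun a b => intervalIntegrable_cexp_mul (-(Complex.I * ω)) (hf a b)) 0)
  have hQ := (isPrimitive_cexp (-(Complex.I * ω))).mul
    ((IsPrimitive.integral (fun a b => intervalIntegrable_cexp_mul (Complex.I * ω) (hf a b))
      L).const_mul (-1))
  have hone : ∀ x : ℝ, Complex.exp (Complex.I * ω * x) * Complex.exp (-(Complex.I * ω) * x) = 1 :=
    fun x => by rw [neg_mul, cexp_mul_cexp_neg]
  have hsq : (Complex.I * ω) ^ 2 = -ω ^ 2 := by rw [mul_pow, Complex.I_sq, neg_one_mul]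
  have hsymm : ∀ x : ℝ, ∫ y in x..L, Complex.exp (Complex.I * ω * y) * f y =
      -1 * ∫ y in L..x, Complex.exp (Complex.I * ω * y) * f y := fun x => by
    rw [intervalIntegral.integral_symm, neg_one_mul]
  have hU := fun x => hsymm x ▸ greenPotential.eq_1 L ω f x
  have hU' := fun x => hsymm x ▸ greenPotentialDeriv.eq_1 L ω f x
  refine ⟨((hP.add hQ).const_mul (Complex.I * ω / 2)).congr hU fun x => ?_,
    ((hP.sub hQ).const_mul (Complex.I * ω / 2 * (Complex.I * ω))).congr hU' fun x => ?_⟩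
  · rw [hU']
    ring
  · linear_combination (Complex.I * ω) ^ 2 * hU x - (greenPotential L ω f x + f x) * hsq -
      f x * (Complex.I * ω) ^ 2 * hone x

theorem greenPotentialDeriv_zero :
    greenPotentialDeriv L ω f 0 = -(Complex.I * ω) * greenPotential L ω f 0 := by
  simp only [greenPotential, greenPotentialDeriv, intervalIntegral.integral_same]
  ring

theorem greenPotentialDeriv_right :
    greenPotentialDeriv L ω f L = Complex.I * ω * greenPotential L ω f L := by
  simp only [greenPotential, greenPotentialDeriv, intervalIntegral.integral_same]
  ring

theorem greenPotential_congr (hfg : ∀ x ∈ Icc 0 L, f x = g x) {x : ℝ} (hx : x ∈ Icc 0 L) :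
    greenPotential L ω f x = greenPotential L ω g x := by
  have hleft : ∀ y ∈ uIcc 0 x, f y = g y := fun y hy =>
    hfg y (Icc_subset_Icc_right hx.2 (uIcc_of_le hx.1 ▸ hy))
  have hright : ∀ y ∈ uIcc x L, f y = g y := fun y hy =>
    hfg y (Icc_subset_Icc_left hx.1 (uIcc_of_le hx.2 ▸ hy))
  rw [greenPotential, greenPotential,
    intervalIntegral.integral_congr fun y hy => congrArg (_ * ·) (hleft y hy),
    intervalIntegral.integral_congr fun y hy => congrArg (_ * ·) (hright y hy)]

end GreenPotential

/-- Radiation conditions at the ends of `[0, L]`, for a function `u` with derivative `w`: outside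
`[0, L]`, where the equation is `u'' + ω² u = 0`, they say that `u` is a multiple of `e^{-iωx}` to
the left and of `e^{iωx}` to the right. -/
structure IsOutgoing (L : ℝ) (ω : ℂ) (u w : ℝ → ℂ) : Prop where
  left : w 0 = -(Complex.I * ω) * u 0
  right : w L = Complex.I * ω * u L

/-- `e^{-iωy} (u' + iωu)` and `e^{iωy} (u' - iωu)` are primitives of `-ω² e^{∓iωy} (q - 1) u`, and
vanish at `0` and at `L` respectively. -/
theorem SolvesHelmholtz.greenPotential_eq {L : ℝ} {q : ℝ → ℂ} {ω : ℂ} {u w : ℝ → ℂ}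
    (h : SolvesHelmholtz q ω u w) (hout : IsOutgoing L ω u w) (hω : ω ≠ 0) (x : ℝ) :
    greenPotential L ω (fun y => (q y - 1) * u y) x = u x := by
  have hwave : ∀ c : ℂ, c ^ 2 = -ω ^ 2 → ∀ a b : ℝ,
      Complex.exp (c * b) * (w b - c * u b) - Complex.exp (c * a) * (w a - c * u a) =
        -ω ^ 2 * ∫ y in a..b, Complex.exp (c * y) * ((q y - 1) * u y) := fun c hc a b => by
    rw [← intervalIntegral.integral_const_mul]
    refine (((isPrimitive_cexp c).mul (h.isPrimitive_deriv.sub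
      (h.isPrimitive.const_mul c))).sub_eq a b).trans
      (intervalIntegral.integral_congr fun y _ => ?_)
    linear_combination (-Complex.exp (c * y) * u y) * hc
  have hsq : (Complex.I * ω) ^ 2 = -ω ^ 2 := by rw [mul_pow, Complex.I_sq, neg_one_mul]
  have hleft := hwave (-(Complex.I * ω)) (by rw [neg_sq, hsq]) 0 x
  have hright := hwave (Complex.I * ω) hsq x L
  rw [hout.left, sub_self, mul_zero, sub_zero] at hleft
  rw [hout.right, sub_self, mul_zero, zero_sub] at hright
  have hone : Complex.exp (Complex.I * ω * x) * Complex.exp (-(Complex.I * ω) * x) = 1 := by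
    rw [neg_mul, cexp_mul_cexp_neg]
  refine mul_left_cancel₀ (neg_ne_zero.2 (pow_ne_zero 2 hω)) ?_
  rw [greenPotential]
  linear_combination (-Complex.I * ω / 2 * Complex.exp (Complex.I * ω * x)) * hleft
    + (-Complex.I * ω / 2 * Complex.exp (-(Complex.I * ω) * x)) * hright
    + (Complex.I * ω * (Complex.I * ω * u x)) * hone + u x * hsq

/-- The coefficients allowed in the Helmholtz equation: bounded measurable complex functions. -/
def boundedMeasurable : Submodule ℂ (ℝ → ℂ) where
  carrier := {q | Measurable q ∧ ∃ K : ℝ, ∀ x, ‖q x‖ ≤ K}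
  add_mem' := fun ⟨hf, K, hK⟩ ⟨hg, K', hK'⟩ =>
    ⟨hf.add hg, K + K', fun x => norm_add_le_of_le (hK x) (hK' x)⟩
  zero_mem' := ⟨measurable_const, 0, fun _ => norm_zero.le⟩
  smul_mem' := fun c _ ⟨hf, K, hK⟩ =>
    ⟨hf.const_smul c, ‖c‖ * K, fun x =>
      (norm_smul_le _ _).trans (mul_le_mul_of_nonneg_left (hK x) (norm_nonneg c))⟩

theorem mem_boundedMeasurable {q : ℝ → ℂ} :
    q ∈ boundedMeasurable ↔ Measurable q ∧ ∃ K : ℝ, ∀ x, ‖q x‖ ≤ K :=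
  Iff.rfl

theorem intervalIntegrable_mul_of_mem_boundedMeasurable {q f : ℝ → ℂ}
    (hq : q ∈ boundedMeasurable) {a b : ℝ} (hf : IntervalIntegrable f volume a b) :
    IntervalIntegrable (fun x => q x * f x) volume a b := by
  obtain ⟨hm, K, hK⟩ := mem_boundedMeasurable.1 hq
  have hae : ∀ᵐ x ∂volume, ‖q x‖ ≤ K := Eventually.of_forall hK
  exact ⟨hf.1.bdd_mul hm.aestronglyMeasurable (ae_restrict_of_ae hae),
    hf.2.bdd_mul hm.aestronglyMeasurable (ae_restrict_of_ae hae)⟩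

namespace AdmissibleSym

variable {L np : ℝ} {n : ℝ → ℝ}

theorem one_le (hn : n ∈ AdmissibleSym L 1 np) (x : ℝ) : 1 ≤ n x := by
  by_cases hx : x ∈ Icc 0 L
  exacts [(hn.2.1 x hx).1, (hn.2.2.1 x hx).ge]

theorem le (hn : n ∈ AdmissibleSym L 1 np) (hL : 0 ≤ L) (x : ℝ) : n x ≤ np := by
  by_cases hx : x ∈ Icc 0 L
  · exact (hn.2.1 x hx).2
  · have h0 := hn.2.1 0 (left_mem_Icc.2 hL)
    exact (hn.2.2.1 x hx).trans_le (h0.1.trans h0.2)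

theorem ne_zero (hn : n ∈ AdmissibleSym L 1 np) (x : ℝ) : n x ≠ 0 :=
  (zero_lt_one.trans_le (one_le hn x)).ne'

theorem norm_permittivity_le (hn : n ∈ AdmissibleSym L 1 np) (hL : 0 ≤ L) (x : ℝ) :
    ‖permittivity n x‖ ≤ np ^ 2 := by
  have h0 : 0 ≤ n x := zero_le_one.trans (one_le hn x)
  rw [permittivity, norm_pow, Complex.norm_of_nonneg h0]
  gcongr
  exact le hn hL x

theorem permittivity_mem (hn : n ∈ AdmissibleSym L 1 np) (hL : 0 ≤ L) :
    permittivity n ∈ boundedMeasurable :=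
  mem_boundedMeasurable.2
    ⟨(Complex.measurable_ofReal.comp hn.1).pow_const 2, np ^ 2, norm_permittivity_le hn hL⟩

theorem permittivity_sub_one_mem (hn : n ∈ AdmissibleSym L 1 np) (hL : 0 ≤ L) :
    (fun x => permittivity n x - 1) ∈ boundedMeasurable :=
  sub_mem (permittivity_mem hn hL)
    (mem_boundedMeasurable.2 ⟨measurable_const, 1, fun _ => norm_one.le⟩)

theorem permittivity_sub_one_eq_zero (hn : n ∈ AdmissibleSym L 1 np) {x : ℝ} (hx : x ∉ Icc 0 L) :
    permittivity n x - 1 = 0 := by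
  rw [permittivity, hn.2.2.1 x hx, Complex.ofReal_one, one_pow, sub_self]

theorem permittivity_reflect (hn : n ∈ AdmissibleSym L 1 np) (x : ℝ) :
    permittivity n (L - x) = permittivity n x := by
  rw [permittivity, permittivity, hn.2.2.2]

end AdmissibleSym

section Resonance

variable {L np : ℝ} {n : ℝ → ℝ} {ω : ℂ} {u w : ℝ → ℂ}

theorem IsResonancePair.ne_zero (h : IsResonancePair L n ω u) : ω ≠ 0 := by
  rintro rfl
  exact h.nontrivial (funext fun x => by rw [h.eq, zero_pow two_ne_zero, zero_mul, Pi.zero_apply])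

theorem IsResonancePair.exists_solvesHelmholtz (h : IsResonancePair L n ω u) (hL : 0 ≤ L)
    (hn : n ∈ AdmissibleSym L 1 np) :
    ∃ w, SolvesHelmholtz (permittivity n) ω u w ∧ IsOutgoing L ω u w := by
  set f : ℝ → ℂ := fun y => (permittivity n y - 1) * u y with hf
  have hint : ∀ a b, IntervalIntegrable f volume a b := fun a b =>
    intervalIntegrable_mul_of_mem_boundedMeasurable (AdmissibleSym.permittivity_sub_one_mem hn hL)
      (h.locallyIntegrable.integrableOn_isCompact isCompact_uIcc).intervalIntegrable
  have hsupp : ∀ x ∉ Icc 0 L, f x = 0 := fun x hx => by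
    simp only [hf, AdmissibleSym.permittivity_sub_one_eq_zero hn hx, zero_mul]
  have hu : u = greenPotential L ω f := funext fun x => by
    rw [← integral_green_mul_eq hL h.ne_zero hint hsupp, h.eq]
    simp only [hf, permittivity, mul_assoc]
  obtain ⟨hU, hU'⟩ := isPrimitive_greenPotential (L := L) (ω := ω) hint
  refine ⟨greenPotentialDeriv L ω f, ⟨?_, ?_⟩, ?_, ?_⟩
  · rwa [← hu] at hU
  · rw [← hu] at hU'
    exact hU'.congr (fun _ => rfl) fun x => by ring
  · rw [greenPotentialDeriv_zero, ← hu]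
  · rw [greenPotentialDeriv_right, ← hu]

theorem SolvesHelmholtz.exists_isResonancePair
    (h : SolvesHelmholtz ((Icc 0 L).indicator (permittivity n)) ω u w)
    (hout : IsOutgoing L ω u w) (hL : 0 ≤ L) (hn : n ∈ AdmissibleSym L 1 np) (hω : ω ≠ 0)
    (hu : u 0 ≠ 0) : ∃ v, IsResonancePair L n ω v := by
  set f : ℝ → ℂ := fun y => (permittivity n y - 1) * u y with hf
  have hint : ∀ a b, IntervalIntegrable f volume a b := fun a b =>
    intervalIntegrable_mul_of_mem_boundedMeasurable (AdmissibleSym.permittivity_sub_one_mem hn hL)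
      (h.continuous.intervalIntegrable a b)
  have hsupp : ∀ x ∉ Icc 0 L, f x = 0 := fun x hx => by
    simp only [hf, AdmissibleSym.permittivity_sub_one_eq_zero hn hx, zero_mul]
  have heq : ∀ x ∈ Icc 0 L, greenPotential L ω f x = u x := fun x hx =>
    (greenPotential_congr (fun y hy => by rw [indicator_of_mem hy]) hx).trans
      (h.greenPotential_eq hout hω x)
  have hsource : ∀ y, (permittivity n y - 1) * greenPotential L ω f y = f y := fun y => by
    by_cases hy : y ∈ Icc 0 L
    · rw [heq y hy]
    · rw [hsupp y hy, AdmissibleSym.permittivity_sub_one_eq_zero hn hy, zero_mul]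
  refine ⟨greenPotential L ω f, (isPrimitive_greenPotential hint).1.continuous.locallyIntegrable,
    fun h0 => hu ?_, fun x => ?_⟩
  · rw [← heq 0 (left_mem_Icc.2 hL), h0, Pi.zero_apply]
  · rw [← integral_green_mul_eq hL hω hint hsupp]
    simp only [← hsource, permittivity, mul_assoc]

end Resonance

section Volterra

set_option maxSynthPendingDepth 3

variable {L : ℝ}

theorem continuous_IccExtend_coe (hL : 0 ≤ L) (v : C(Icc 0 L, ℂ)) : Continuous (IccExtend hL v) :=
  v.continuous.Icc_extend'

theorem intervalIntegrable_mul_IccExtend (hL : 0 ≤ L) (q : boundedMeasurable) (v : C(Icc 0 L, ℂ))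
    (a b : ℝ) : IntervalIntegrable (fun y => (q : ℝ → ℂ) y * IccExtend hL v y) volume a b :=
  intervalIntegrable_mul_of_mem_boundedMeasurable q.2
    ((continuous_IccExtend_coe hL v).intervalIntegrable a b)

theorem norm_integral_mul_IccExtend_le (hL : 0 ≤ L) {q : ℝ → ℂ} {K : ℝ} (hK : ∀ x, ‖q x‖ ≤ K)
    (v : C(Icc 0 L, ℂ)) {x : ℝ} (hx : 0 ≤ x) :
    ‖∫ y in (0 : ℝ)..x, q y * IccExtend hL v y‖ ≤ K * ∫ y in (0 : ℝ)..x, ‖IccExtend hL v y‖ := by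
  rw [← intervalIntegral.integral_const_mul]
  refine intervalIntegral.norm_integral_le_of_norm_le hx (Eventually.of_forall fun y _ => ?_)
    (((continuous_IccExtend_coe hL v).norm.intervalIntegrable 0 x).const_mul K)
  rw [norm_mul]
  gcongr
  exact hK y

/-- The bilinear map `(q, v) ↦ ∫₀ˣ q v`, with values in the continuous functions on `[0, L]`. -/
noncomputable def integralMul (hL : 0 ≤ L) :
    boundedMeasurable →ₗ[ℂ] C(Icc 0 L, ℂ) →ₗ[ℂ] C(Icc 0 L, ℂ) :=
  LinearMap.mk₂ ℂ
    (fun q v => ⟨fun x => ∫ y in (0 : ℝ)..x, (q : ℝ → ℂ) y * IccExtend hL v y,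
      (intervalIntegral.continuous_primitive (intervalIntegrable_mul_IccExtend hL q v) 0).comp
        continuous_subtype_val⟩)
    (fun q q' v => ContinuousMap.ext fun _ =>
      (intervalIntegral.integral_congr fun _ _ => add_mul _ _ _).trans <|
        intervalIntegral.integral_add (intervalIntegrable_mul_IccExtend hL q v _ _)
          (intervalIntegrable_mul_IccExtend hL q' v _ _))
    (fun c _ _ => ContinuousMap.ext fun _ =>
      (intervalIntegral.integral_congr fun _ _ => mul_assoc _ _ _).trans <|
        intervalIntegral.integral_const_mul c _)
    (fun q v v' => ContinuousMap.ext fun _ =>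
      (intervalIntegral.integral_congr fun _ _ => mul_add _ _ _).trans <|
        intervalIntegral.integral_add (intervalIntegrable_mul_IccExtend hL q v _ _)
          (intervalIntegrable_mul_IccExtend hL q v' _ _))
    (fun c _ _ => ContinuousMap.ext fun _ =>
      (intervalIntegral.integral_congr fun _ _ => mul_left_comm _ _ _).trans <|
        intervalIntegral.integral_const_mul c _)

theorem exists_norm_integralMul_le (hL : 0 ≤ L) (q : boundedMeasurable) :
    ∃ C, ∀ v, ‖integralMul hL q v‖ ≤ C * ‖v‖ := by
  obtain ⟨-, K, hK⟩ := mem_boundedMeasurable.1 q.2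
  have hK0 : 0 ≤ K := (norm_nonneg _).trans (hK 0)
  refine ⟨K * L, fun v => (ContinuousMap.norm_le _ (by positivity)).2 fun x => ?_⟩
  have hv : ∫ y in (0 : ℝ)..x, ‖IccExtend hL v y‖ ≤ ‖v‖ * L := calc
    _ ≤ ∫ _ in (0 : ℝ)..x, ‖v‖ := intervalIntegral.integral_mono_on x.2.1
      ((continuous_IccExtend_coe hL v).norm.intervalIntegrable _ _)
      intervalIntegrable_const fun y _ => v.norm_coe_le_norm _
    _ = ‖v‖ * x := by rw [intervalIntegral.integral_const, sub_zero, smul_eq_mul, mul_comm]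
    _ ≤ ‖v‖ * L := by gcongr; exact x.2.2
  calc _ ≤ K * ∫ y in (0 : ℝ)..x, ‖IccExtend hL v y‖ :=
      norm_integral_mul_IccExtend_le hL hK v x.2.1
    _ ≤ K * (‖v‖ * L) := by gcongr
    _ = K * L * ‖v‖ := by ring

/-- The Volterra operator `v ↦ ∫₀ˣ q v` on continuous functions on `[0, L]`, depending linearly on
the coefficient `q`. -/
noncomputable def volterra (hL : 0 ≤ L) :
    boundedMeasurable →ₗ[ℂ] C(Icc 0 L, ℂ) →L[ℂ] C(Icc 0 L, ℂ) where
  toFun q := (integralMul hL q).mkContinuousOfExistsBound (exists_norm_integralMul_le hL q)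
  map_add' q q' := ContinuousLinearMap.ext fun v => (integralMul hL).map_add₂ q q' v
  map_smul' c q := ContinuousLinearMap.ext fun v => (integralMul hL).map_smul₂ c q v

theorem volterra_apply (hL : 0 ≤ L) (q : boundedMeasurable) (v : C(Icc 0 L, ℂ)) (x : Icc 0 L) :
    volterra hL q v x = ∫ y in (0 : ℝ)..x, (q : ℝ → ℂ) y * IccExtend hL v y :=
  rfl

theorem isUnit_one_sub_of_norm_pow_lt_one {R : Type*} [NormedRing R] [HasSummableGeomSeries R]
    {T : R} {k : ℕ} (hk : ‖T ^ k‖ < 1) : IsUnit (1 - T) := by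
  have hcomm : Commute (1 - T) (∑ i ∈ Finset.range k, T ^ i) :=
    Commute.sum_right _ _ _ fun i _ => ((Commute.one_left T).sub_left (.refl T)).pow_right i
  exact (hcomm.isUnit_mul_iff.1 (mul_neg_geom_sum T k ▸ isUnit_one_sub_of_norm_lt_one hk)).1

variable {T : C(Icc 0 L, ℂ) →L[ℂ] C(Icc 0 L, ℂ)} {c : ℝ}

theorem norm_pow_apply_le (hL : 0 ≤ L) (hc : 0 ≤ c)
    (hT : ∀ v x, ‖T v x‖ ≤ c * ∫ y in (0 : ℝ)..x, ‖IccExtend hL v y‖) (k : ℕ)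
    (v : C(Icc 0 L, ℂ)) (x : Icc 0 L) : ‖(T ^ k) v x‖ ≤ (c * x) ^ k / k.factorial * ‖v‖ := by
  induction k generalizing x with
  | zero => simpa using v.norm_coe_le_norm x
  | succ k ih =>
    have hint : ∫ y in (0 : ℝ)..x, ‖IccExtend hL ((T ^ k) v) y‖ ≤
        ∫ y in (0 : ℝ)..x, c ^ k / k.factorial * ‖v‖ * y ^ k := by
      refine intervalIntegral.integral_mono_on x.2.1
        ((continuous_IccExtend_coe hL _).norm.intervalIntegrable _ _)
        (Continuous.intervalIntegrable (by fun_prop) _ _) fun y hy => ?_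
      have hyL : y ∈ Icc 0 L := ⟨hy.1, hy.2.trans x.2.2⟩
      rw [IccExtend_of_mem hL _ hyL]
      exact (ih ⟨y, hyL⟩).trans (by rw [mul_pow]; exact le_of_eq (by ring))
    calc ‖(T ^ (k + 1)) v x‖ = ‖T ((T ^ k) v) x‖ := by rw [pow_succ']; rfl
      _ ≤ c * ∫ y in (0 : ℝ)..x, ‖IccExtend hL ((T ^ k) v) y‖ := hT _ x
      _ ≤ c * ∫ y in (0 : ℝ)..x, c ^ k / k.factorial * ‖v‖ * y ^ k := by gcongr
      _ = (c * x) ^ (k + 1) / (k + 1).factorial * ‖v‖ := by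
        rw [intervalIntegral.integral_const_mul, integral_pow, Nat.factorial_succ,
          zero_pow k.succ_ne_zero, sub_zero]
        push_cast
        field_simp
        ring

theorem isUnit_one_sub_of_volterra (hL : 0 ≤ L) (hc : 0 ≤ c)
    (hT : ∀ v x, ‖T v x‖ ≤ c * ∫ y in (0 : ℝ)..x, ‖IccExtend hL v y‖) : IsUnit (1 - T) := by
  obtain ⟨k, hk⟩ := ((FloorSemiring.tendsto_pow_div_factorial_atTop (c * L)).eventually_lt_const
    zero_lt_one).exists
  suffices hnorm : ‖T ^ k‖ ≤ (c * L) ^ k / k.factorial from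
    isUnit_one_sub_of_norm_pow_lt_one (hnorm.trans_lt hk)
  refine ContinuousLinearMap.opNorm_le_bound _ (by positivity) fun v =>
    (ContinuousMap.norm_le _ (by positivity)).2 fun x =>
      (norm_pow_apply_le hL hc hT k v x).trans ?_
  have hx := x.2
  gcongr
  exacts [mul_nonneg hc hx.1, hx.2]

end Volterra

section Jost

set_option maxSynthPendingDepth 3

variable {L : ℝ} (hL : 0 ≤ L)

/-- The coordinate function `x ↦ x` on `[0, L]`. -/
def coordinate (L : ℝ) : C(Icc 0 L, ℂ) :=
  ⟨fun x => ((x : ℝ) : ℂ), Complex.continuous_ofReal.comp continuous_subtype_val⟩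

/-- The operator `v ↦ -z² ∫₀ˣ ∫₀ʸ q v` on continuous functions on `[0, L]`. -/
noncomputable def doubleVolterra (z : ℂ) (q : boundedMeasurable) :
    C(Icc 0 L, ℂ) →L[ℂ] C(Icc 0 L, ℂ) :=
  -z ^ 2 • (volterra hL ⟨1, measurable_const, 1, fun _ => norm_one.le⟩ * volterra hL q)

theorem doubleVolterra_apply (z : ℂ) (q : boundedMeasurable) (v : C(Icc 0 L, ℂ)) (x : Icc 0 L) :
    doubleVolterra hL z q v x =
      -z ^ 2 * ∫ y in (0 : ℝ)..x, IccExtend hL (volterra hL q v) y := by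
  refine congrArg (-z ^ 2 * ·) ((volterra_apply hL _ _ x).trans ?_)
  exact intervalIntegral.integral_congr fun y _ => one_mul _

theorem isUnit_one_sub_doubleVolterra (z : ℂ) (q : boundedMeasurable) :
    IsUnit (1 - doubleVolterra hL z q) := by
  obtain ⟨-, K, hK⟩ := mem_boundedMeasurable.1 q.2
  have hK0 : 0 ≤ K := (norm_nonneg _).trans (hK 0)
  refine isUnit_one_sub_of_volterra hL (c := ‖z‖ ^ 2 * (L * K)) (by positivity) fun v x => ?_
  have hnonneg : ∀ y, 0 ≤ ‖IccExtend hL v y‖ := fun y => norm_nonneg _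
  have hint : ∀ a b, IntervalIntegrable (fun y => ‖IccExtend hL v y‖) volume a b := fun a b =>
    (continuous_IccExtend_coe hL v).norm.intervalIntegrable a b
  have hinner : ∀ y ∈ uIoc 0 (x : ℝ), ‖IccExtend hL (volterra hL q v) y‖ ≤
      K * ∫ y in (0 : ℝ)..x, ‖IccExtend hL v y‖ := fun y hy => by
    rw [uIoc_of_le x.2.1] at hy
    have hyL : y ∈ Icc 0 L := ⟨hy.1.le, hy.2.trans x.2.2⟩
    rw [IccExtend_of_mem hL _ hyL, volterra_apply]
    refine (norm_integral_mul_IccExtend_le hL hK v hy.1.le).trans ?_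
    gcongr
    exact intervalIntegral.integral_mono_interval le_rfl hy.1.le hy.2
      (Eventually.of_forall hnonneg) (hint _ _)
  rw [doubleVolterra_apply, norm_mul, norm_neg, norm_pow, mul_assoc, mul_assoc]
  gcongr
  refine (intervalIntegral.norm_integral_le_of_norm_le_const hinner).trans ?_
  rw [sub_zero, abs_of_nonneg x.2.1, mul_comm]
  gcongr
  · exact mul_nonneg hK0 (intervalIntegral.integral_nonneg x.2.1 fun y _ => hnonneg y)
  · exact x.2.2

/-- The Jost solution on `[0, L]`: the solution of `u'' + z² q u = 0` with `u(0) = 1` and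
`u'(0) = -iz`, which continues the left-moving wave `e^{-izx}` on `x < 0`. -/
noncomputable def jost (z : ℂ) (q : boundedMeasurable) : C(Icc 0 L, ℂ) :=
  Ring.inverse (1 - doubleVolterra hL z q) (1 - (Complex.I * z) • coordinate L)

/-- The characteristic function `u'(L) - iz u(L)` of the Jost solution `u`; its zeros `z ≠ 0` are
the scattering resonances. -/
noncomputable def charFun (z : ℂ) (q : boundedMeasurable) : ℂ :=
  -(Complex.I * z) - z ^ 2 * volterra hL q (jost hL z q) ⟨L, right_mem_Icc.2 hL⟩ -
    Complex.I * z * jost hL z q ⟨L, right_mem_Icc.2 hL⟩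

variable {hL}

theorem eq_smul_jost_iff {z : ℂ} {q : boundedMeasurable} {v : C(Icc 0 L, ℂ)} {c : ℂ} :
    v = c • jost hL z q ↔
      v - doubleVolterra hL z q v = c • (1 - (Complex.I * z) • coordinate L) := by
  have hunit := isUnit_one_sub_doubleVolterra hL z q
  constructor
  · rintro rfl
    rw [map_smul, ← smul_sub]
    exact congrArg (fun T : C(Icc 0 L, ℂ) →L[ℂ] C(Icc 0 L, ℂ) =>
      c • T (1 - (Complex.I * z) • coordinate L)) (Ring.mul_inverse_cancel _ hunit)
  · intro hv
    rw [jost, ← map_smul, ← hv]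
    exact congrArg (fun T : C(Icc 0 L, ℂ) →L[ℂ] C(Icc 0 L, ℂ) => T v)
      (Ring.inverse_mul_cancel _ hunit).symm

theorem contDiff_ringInverse_one_sub {X R : Type*} [NormedAddCommGroup X] [NormedSpace ℂ X]
    [NormedRing R] [NormedAlgebra ℂ R] [HasSummableGeomSeries R] {k : WithTop ℕ∞} {T : X → R}
    (hT : ContDiff ℂ k T) (hunit : ∀ p, IsUnit (1 - T p)) :
    ContDiff ℂ k (fun p => Ring.inverse (1 - T p)) := by
  refine contDiff_iff_contDiffAt.2 fun p => ?_
  obtain ⟨y, hy⟩ := hunit p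
  exact ContDiffAt.comp (g := Ring.inverse) p (hy ▸ contDiffAt_ringInverse ℂ y)
    (contDiff_const.sub hT).contDiffAt

theorem contDiff_volterra_line (q δ : boundedMeasurable) (k : WithTop ℕ∞) :
    ContDiff ℂ k (fun p : ℂ × ℂ => volterra hL (q + p.2 • δ)) := by
  simp only [map_add, map_smul]
  fun_prop

theorem contDiff_jost (q δ : boundedMeasurable) (k : WithTop ℕ∞) :
    ContDiff ℂ k (fun p : ℂ × ℂ => jost hL p.1 (q + p.2 • δ)) := by
  have hT : ContDiff ℂ k (fun p : ℂ × ℂ => doubleVolterra hL p.1 (q + p.2 • δ)) :=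
    (contDiff_fst.pow 2).neg.smul (contDiff_const.mul (contDiff_volterra_line q δ k))
  exact (contDiff_ringInverse_one_sub hT fun p => isUnit_one_sub_doubleVolterra hL _ _).clm_apply
    (contDiff_const.sub ((contDiff_const.mul contDiff_fst).smul contDiff_const))

theorem contDiff_charFun (q δ : boundedMeasurable) (k : WithTop ℕ∞) :
    ContDiff ℂ k (fun p : ℂ × ℂ => charFun hL p.1 (q + p.2 • δ)) := by
  have heval : ∀ {f : ℂ × ℂ → C(Icc 0 L, ℂ)}, ContDiff ℂ k f →
      ContDiff ℂ k (fun p => f p ⟨L, right_mem_Icc.2 hL⟩) := fun hf =>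
    ((ContinuousMap.evalCLM ℂ ⟨L, right_mem_Icc.2 hL⟩ :
      C(Icc 0 L, ℂ) →L[ℂ] ℂ)).contDiff.comp hf
  have hjost := contDiff_jost (hL := hL) q δ k
  exact ((contDiff_const.mul contDiff_fst).neg.sub ((contDiff_fst.pow 2).mul
    (heval ((contDiff_volterra_line q δ k).clm_apply hjost)))).sub
      ((contDiff_const.mul contDiff_fst).mul (heval hjost))

theorem differentiable_charFun (q : boundedMeasurable) :
    Differentiable ℂ fun z => charFun hL z q := by
  simpa only [Function.comp_def, zero_smul, add_zero] using
    ((contDiff_charFun (hL := hL) q 0 1).comp (contDiff_prodMk_left 0)).differentiable one_ne_zero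

theorem eq_add_doubleVolterra {z c : ℂ} {q : boundedMeasurable} {v : C(Icc 0 L, ℂ)} {u w : ℝ → ℂ}
    (h : IsPrimitive u w) (hw : ∀ x : Icc 0 L, w x = c - z ^ 2 * volterra hL q v x)
    (x : Icc 0 L) : u x = u 0 + c * x + doubleVolterra hL z q v x := by
  have hint : Continuous (IccExtend hL (volterra hL q v)) := continuous_IccExtend_coe hL _
  have hux : u x - u 0 = ∫ y in (0 : ℝ)..x, (c + -z ^ 2 * IccExtend hL (volterra hL q v) y) := by
    refine (h.sub_eq 0 x).trans (intervalIntegral.integral_congr fun y hy => ?_)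
    have hyL : y ∈ Icc 0 L := Icc_subset_Icc_right x.2.2 (uIcc_of_le x.2.1 ▸ hy)
    rw [IccExtend_of_mem hL _ hyL, neg_mul, ← sub_eq_add_neg]
    exact hw ⟨y, hyL⟩
  rw [intervalIntegral.integral_add intervalIntegrable_const
    ((hint.const_mul (-z ^ 2)).intervalIntegrable _ _), intervalIntegral.integral_const,
    intervalIntegral.integral_const_mul, ← doubleVolterra_apply, sub_zero,
    Complex.real_smul] at hux
  rw [eq_add_of_sub_eq hux]
  ring

theorem exists_solvesHelmholtz_jost (z : ℂ) (q : boundedMeasurable) :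
    ∃ u w, SolvesHelmholtz ((Icc 0 L).indicator q) z u w ∧ u 0 = 1 ∧ w 0 = -(Complex.I * z) ∧
      w L = charFun hL z q + Complex.I * z * u L ∧ ∀ x : Icc 0 L, u x = jost hL z q x := by
  set φ := jost hL z q
  set r : ℝ → ℂ := fun y => -z ^ 2 * ((Icc 0 L).indicator q y * IccExtend hL φ y) with hr
  obtain ⟨hqm, K, hK⟩ := mem_boundedMeasurable.1 q.2
  have hqI : (Icc 0 L).indicator (q : ℝ → ℂ) ∈ boundedMeasurable :=
    mem_boundedMeasurable.2 ⟨hqm.indicator measurableSet_Icc, K, fun x =>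
      (norm_indicator_le_norm_self _ x).trans (hK x)⟩
  have hrint : ∀ a b, IntervalIntegrable r volume a b := fun a b =>
    (intervalIntegrable_mul_IccExtend hL ⟨_, hqI⟩ φ a b).const_mul _
  set w : ℝ → ℂ := fun x => -(Complex.I * z) + ∫ y in (0 : ℝ)..x, r y with hw
  have hwr : IsPrimitive w r := (IsPrimitive.integral hrint 0).const_add _
  set u : ℝ → ℂ := fun x => 1 + ∫ y in (0 : ℝ)..x, w y with hu
  have huw : IsPrimitive u w :=
    (IsPrimitive.integral (fun a b => hwr.continuous.intervalIntegrable a b) 0).const_add _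
  have hwφ : ∀ x : Icc 0 L, w x = -(Complex.I * z) - z ^ 2 * volterra hL q φ x := fun x => by
    simp only [hw, hr, volterra_apply, intervalIntegral.integral_const_mul]
    rw [neg_mul, ← sub_eq_add_neg, intervalIntegral.integral_congr fun y hy => ?_]
    have hyL : y ∈ Icc 0 L := Icc_subset_Icc_right x.2.2 (uIcc_of_le x.2.1 ▸ hy)
    simp only [indicator_of_mem hyL]
  have hu0 : u 0 = 1 := by simp [hu]
  have huφ : ∀ x : Icc 0 L, u x = φ x := fun x => by
    have hφ := congrArg (fun v : C(Icc 0 L, ℂ) => v x)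
      (eq_smul_jost_iff (v := φ) (c := 1).1 (one_smul _ _).symm)
    rw [eq_add_doubleVolterra huw hwφ, hu0]
    simp only [one_smul, ContinuousMap.sub_apply, ContinuousMap.one_apply,
      ContinuousMap.smul_apply, smul_eq_mul, coordinate, ContinuousMap.coe_mk] at hφ
    linear_combination -hφ
  refine ⟨u, w, ⟨huw, hwr.congr (fun _ => rfl) fun y => ?_⟩, hu0, by simp [hw], ?_, huφ⟩
  · by_cases hy : y ∈ Icc 0 L
    · simp only [hr, IccExtend_of_mem hL _ hy, huφ ⟨y, hy⟩]
    · simp only [hr, indicator_of_notMem hy, zero_mul, mul_zero]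
  · rw [hwφ ⟨L, right_mem_Icc.2 hL⟩, huφ ⟨L, right_mem_Icc.2 hL⟩, charFun]
    ring

theorem SolvesHelmholtz.eq_jost {q : boundedMeasurable} {z : ℂ} {u w : ℝ → ℂ}
    (h : SolvesHelmholtz q z u w) (h0 : w 0 = -(Complex.I * z) * u 0) (x : Icc 0 L) :
    u x = u 0 * jost hL z q x := by
  let v : C(Icc 0 L, ℂ) := ⟨fun x => u x, h.continuous.comp continuous_subtype_val⟩
  have hw : ∀ x : Icc 0 L, w x = w 0 - z ^ 2 * volterra hL q v x := fun x => by
    rw [volterra_apply, sub_eq_add_neg, ← neg_mul, ← intervalIntegral.integral_const_mul]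
    refine (h.isPrimitive_deriv.eq_add 0 x).trans (congrArg _ ?_)
    refine intervalIntegral.integral_congr fun y hy => ?_
    have hyL : y ∈ Icc 0 L := Icc_subset_Icc_right x.2.2 (uIcc_of_le x.2.1 ▸ hy)
    simp only [IccExtend_of_mem hL _ hyL]
    rfl
  have hv : v = u 0 • jost hL z q := eq_smul_jost_iff.2 <| ContinuousMap.ext fun x => by
    have hux := eq_add_doubleVolterra h.isPrimitive hw x
    simp only [ContinuousMap.sub_apply, ContinuousMap.smul_apply, ContinuousMap.one_apply,
      smul_eq_mul, coordinate, ContinuousMap.coe_mk, v] at hux ⊢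
    linear_combination hux + (x : ℂ) * h0
  exact congrArg (fun v : C(Icc 0 L, ℂ) => v x) hv

end Jost

section Outgoing

variable {L K : ℝ} {ω : ℂ} {u w : ℝ → ℂ}

theorem SolvesHelmholtz.wronskian_sub {q₁ q₂ : ℝ → ℂ} {u₁ w₁ u₂ w₂ : ℝ → ℂ}
    (h₁ : SolvesHelmholtz q₁ ω u₁ w₁) (h₂ : SolvesHelmholtz q₂ ω u₂ w₂) (a b : ℝ) :
    (u₁ b * w₂ b - w₁ b * u₂ b) - (u₁ a * w₂ a - w₁ a * u₂ a) =
      -ω ^ 2 * ∫ x in a..b, (q₂ x - q₁ x) * u₁ x * u₂ x := by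
  rw [← intervalIntegral.integral_const_mul]
  refine (((h₁.isPrimitive.mul h₂.isPrimitive_deriv).sub
    (h₁.isPrimitive_deriv.mul h₂.isPrimitive)).sub_eq a b).trans
    (intervalIntegral.integral_congr fun x _ => ?_)
  ring

theorem IsOutgoing.left_ne_zero (hout : IsOutgoing L ω u w) {q : ℝ → ℂ}
    (h : SolvesHelmholtz q ω u w) (hq : ∀ x, ‖q x‖ ≤ K) (hu : u ≠ 0) : u 0 ≠ 0 := fun h0 =>
  hu (h.eq_zero hq h0 (by rw [hout.left, h0, mul_zero]))

theorem IsOutgoing.right_ne_zero (hout : IsOutgoing L ω u w) {q : ℝ → ℂ}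
    (h : SolvesHelmholtz q ω u w) (hq : ∀ x, ‖q x‖ ≤ K) (hu : u ≠ 0) : u L ≠ 0 := fun hL =>
  hu (h.eq_zero hq hL (by rw [hout.right, hL, mul_zero]))

theorem IsOutgoing.mul_charFun (hout : IsOutgoing L ω u w) {q : ℝ → ℂ}
    (h : SolvesHelmholtz q ω u w) (hL : 0 ≤ L) (q' : boundedMeasurable) :
    u L * charFun hL ω q' =
      -ω ^ 2 * ∫ x in (0 : ℝ)..L, ((q' : ℝ → ℂ) x - q x) * u x * IccExtend hL (jost hL ω q') x := by
  obtain ⟨v, v', hv, hv0, hv0', hvL, hvφ⟩ := exists_solvesHelmholtz_jost (hL := hL) ω q'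
  have hwronskian := h.wronskian_sub hv 0 L
  rw [hout.left, hout.right, hv0, hv0', hvL] at hwronskian
  have hint : ∫ x in (0 : ℝ)..L, ((Icc 0 L).indicator q' x - q x) * u x * v x =
      ∫ x in (0 : ℝ)..L, ((q' : ℝ → ℂ) x - q x) * u x * IccExtend hL (jost hL ω q') x := by
    refine intervalIntegral.integral_congr fun x hx => ?_
    have hxL : x ∈ Icc 0 L := uIcc_of_le hL ▸ hx
    simp only [indicator_of_mem hxL, IccExtend_of_mem hL _ hxL, hvφ ⟨x, hxL⟩]
  rw [← hint, ← hwronskian]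
  ring

theorem IsOutgoing.charFun_eq_zero (hout : IsOutgoing L ω u w) {q : boundedMeasurable}
    (h : SolvesHelmholtz q ω u w) (hL : 0 ≤ L) (huL : u L ≠ 0) : charFun hL ω q = 0 := by
  have hmul := hout.mul_charFun h hL q
  simp only [sub_self, zero_mul, intervalIntegral.integral_zero, mul_zero] at hmul
  exact (mul_eq_zero.1 hmul).resolve_left huL

set_option maxSynthPendingDepth 3 in
theorem differentiable_integral_mul_jost (hL : 0 ≤ L) (z : ℂ) (q δ : boundedMeasurable)
    (hu : Continuous u) :
    Differentiable ℂ fun t : ℂ =>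
      ∫ x in (0 : ℝ)..L, (δ : ℝ → ℂ) x * u x * IccExtend hL (jost hL z (q + t • δ)) x := by
  let v : C(Icc 0 L, ℂ) := ⟨fun x => u x, hu.comp continuous_subtype_val⟩
  have hjost : Differentiable ℂ fun t : ℂ => jost hL z (q + t • δ) :=
    ((contDiff_jost q δ 1).comp (contDiff_prodMk_right z)).differentiable one_ne_zero
  have hpair : Differentiable ℂ fun t : ℂ =>
      volterra hL δ (v * jost hL z (q + t • δ)) ⟨L, right_mem_Icc.2 hL⟩ :=
    ((ContinuousMap.evalCLM ℂ ⟨L, right_mem_Icc.2 hL⟩ :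
      C(Icc 0 L, ℂ) →L[ℂ] ℂ).comp (volterra hL δ)).differentiable.comp
        ((differentiable_const v).mul hjost)
  convert hpair using 2 with t
  refine intervalIntegral.integral_congr fun x hx => ?_
  have hxL : x ∈ Icc 0 L := uIcc_of_le hL ▸ hx
  simp only [IccExtend_of_mem hL _ hxL]
  exact mul_assoc _ (u x) _

theorem IsOutgoing.hasDerivAt_charFun (hout : IsOutgoing L ω u w) {q : boundedMeasurable}
    (h : SolvesHelmholtz q ω u w) (hL : 0 ≤ L) (hu0 : u 0 ≠ 0) (huL : u L ≠ 0)
    (δ : boundedMeasurable) :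
    HasDerivAt (fun t : ℂ => charFun hL ω (q + t • δ))
      (-ω ^ 2 / (u 0 * u L) * ∫ x in (0 : ℝ)..L, (δ : ℝ → ℂ) x * u x ^ 2) 0 := by
  set J : ℂ → ℂ := fun t =>
    ∫ x in (0 : ℝ)..L, (δ : ℝ → ℂ) x * u x * IccExtend hL (jost hL ω (q + t • δ)) x with hJ
  have hJdiff : DifferentiableAt ℂ J 0 :=
    differentiable_integral_mul_jost hL ω q δ h.continuous 0
  have hchar : ∀ t, charFun hL ω (q + t • δ) = t * (-ω ^ 2 / u L * J t) := fun t => by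
    have hmul := hout.mul_charFun h hL (q + t • δ)
    simp only [Submodule.coe_add, Submodule.coe_smul, Pi.add_apply, Pi.smul_apply, smul_eq_mul,
      add_sub_cancel_left, mul_assoc t, intervalIntegral.integral_const_mul] at hmul
    field_simp
    linear_combination hmul
  have hJ0 : u 0 * J 0 = ∫ x in (0 : ℝ)..L, (δ : ℝ → ℂ) x * u x ^ 2 := by
    simp only [hJ, zero_smul, add_zero, ← intervalIntegral.integral_const_mul]
    refine intervalIntegral.integral_congr fun x hx => ?_
    have hxL : x ∈ Icc 0 L := uIcc_of_le hL ▸ hx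
    have hux := h.eq_jost (hL := hL) hout.left ⟨x, hxL⟩
    simp only [IccExtend_of_mem hL _ hxL] at hux ⊢
    linear_combination -(δ : ℝ → ℂ) x * u x * hux
  refine (((hasDerivAt_id (0 : ℂ)).mul (hJdiff.hasDerivAt.const_mul (-ω ^ 2 / u L))).congr_deriv
    ?_).congr_of_eventuallyEq (Eventually.of_forall hchar)
  rw [← hJ0]
  simp only [id, one_mul, zero_mul, add_zero]
  field_simp

end Outgoing

section Width

variable {L np : ℝ} {n : ℝ → ℝ} {ω : ℂ}

theorem exists_isResonancePair_of_charFun_eq_zero (hL : 0 ≤ L) (hn : n ∈ AdmissibleSym L 1 np)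
    {q : boundedMeasurable} (hq : (q : ℝ → ℂ) = permittivity n) (hω : ω ≠ 0)
    (h : charFun hL ω q = 0) : ∃ v, IsResonancePair L n ω v := by
  obtain ⟨v, v', hv, hv0, hv0', hvL, -⟩ := exists_solvesHelmholtz_jost (hL := hL) ω q
  rw [hq] at hv
  exact hv.exists_isResonancePair ⟨by rw [hv0', hv0, mul_one], by rw [hvL, h, zero_add]⟩ hL hn hω
    (hv0 ▸ one_ne_zero)

end Width

section Perturbation

theorem exists_zero_of_norm_lt {f : ℂ → ℂ} {U : Set ℂ} {z : ℂ} {η : ℝ}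
    (hU : Bornology.IsBounded U) (hf : DiffContOnCl ℂ f U) (hη : ∀ w ∈ frontier U, η ≤ ‖f w‖)
    (hz : z ∈ U) (hfz : ‖f z‖ < η) : ∃ w ∈ closure U, f w = 0 := by
  by_contra! hne
  have hη0 : 0 < η := (norm_nonneg _).trans_lt hfz
  have hmax : ‖(f z)⁻¹‖ ≤ η⁻¹ := Complex.norm_le_of_forall_mem_frontier_norm_le hU
    (hf.inv hne) (fun w hw => by
      rw [Pi.inv_apply, norm_inv]; exact inv_anti₀ hη0 (hη w hw)) (subset_closure hz)
  rw [norm_inv, inv_le_inv₀ (norm_pos_iff.2 (hne z (subset_closure hz))) hη0] at hmax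
  exact hmax.not_gt hfz

theorem eventually_exists_zero_of_tendstoUniformlyOn {ι : Type*} {l : Filter ι} {f : ι → ℂ → ℂ}
    {h : ℂ → ℂ} {c : ℂ} {r : ℝ} (hr : 0 < r)
    (hf : ∀ᶠ i in l, DiffContOnCl ℂ (f i) (Metric.ball c r))
    (hlim : TendstoUniformlyOn f h l (Metric.closedBall c r))
    (hcont : ContinuousOn h (Metric.sphere c r)) (hc : h c = 0)
    (hne : ∀ z ∈ Metric.sphere c r, h z ≠ 0) :
    ∀ᶠ i in l, ∃ z ∈ Metric.closedBall c r, f i z = 0 := by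
  obtain ⟨z₁, hz₁, hmin⟩ := (isCompact_sphere c r).exists_isMinOn
    (NormedSpace.sphere_nonempty.2 hr.le) hcont.norm
  have hη : 0 < ‖h z₁‖ / 2 := half_pos (norm_pos_iff.2 (hne z₁ hz₁))
  filter_upwards [hf, Metric.tendstoUniformlyOn_iff.1 hlim _ hη] with i hfi hi
  rw [← closure_ball c hr.ne']
  refine exists_zero_of_norm_lt Metric.isBounded_ball hfi (fun z hz => ?_)
    (Metric.mem_ball_self hr) (η := ‖h z₁‖ / 2) ?_
  · rw [frontier_ball c hr.ne'] at hz
    have hzi := hi z (Metric.sphere_subset_closedBall hz)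
    have hhz : ‖h z₁‖ ≤ ‖h z‖ := hmin hz
    rw [dist_eq_norm] at hzi
    linarith [norm_sub_norm_le (h z) (f i z)]
  · simpa [hc] using hi c (Metric.mem_closedBall_self hr.le)

theorem tendstoUniformlyOn_of_forall_tendsto {ι α β : Type*} [TopologicalSpace α] [UniformSpace β]
    {l : Filter ι} {f : ι → α → β} {h : α → β} {s : Set α} (hs : IsCompact s)
    (hh : ContinuousOn h s)
    (hlim : ∀ x ∈ s, Tendsto (fun p : ι × α => f p.1 p.2) (l ×ˢ 𝓝[s] x) (𝓝 (h x))) :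
    TendstoUniformlyOn f h l s := by
  rw [← tendstoLocallyUniformlyOn_iff_tendstoUniformlyOn_of_compact hs,
    tendstoLocallyUniformlyOn_iff_forall_tendsto]
  exact fun x hx => (((hh x hx).tendsto.comp tendsto_snd).prodMk_nhds (hlim x hx)).mono_right
    (nhds_le_uniformity (h x))

theorem exists_sphere_of_eventually_nhdsNE {α : Type*} [PseudoMetricSpace α] {c : α}
    {p : α → Prop} (h : ∀ᶠ z in 𝓝[≠] c, p z) {R : ℝ} (hR : 0 < R) :
    ∃ r ∈ Ioo 0 R, ∀ z ∈ Metric.sphere c r, p z := by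
  obtain ⟨r₀, hr₀, hball⟩ := Metric.mem_nhdsWithin_iff.1 h
  obtain ⟨r, hr, hrlt⟩ := exists_between (lt_min hr₀ hR)
  refine ⟨r, ⟨hr, hrlt.trans_le (min_le_right _ _)⟩, fun z hz => hball
    ⟨Metric.mem_ball.2 ?_, Metric.ne_of_mem_sphere hz hr.ne'⟩⟩
  exact Metric.mem_sphere.1 hz ▸ hrlt.trans_le (min_le_left _ _)

theorem exists_pow_eq_of_im_pos {D : ℂ} (hD : 0 < D.im) {m : ℕ} (hm : m ≠ 0) :
    ∃ ζ : ℂ, ζ ^ m = D ∧ 0 < ζ.im := by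
  refine ⟨D ^ (m : ℂ)⁻¹, Complex.cpow_nat_inv_pow D hm, ?_⟩
  have hD0 : D ≠ 0 := by rintro rfl; simp at hD
  have harg : 0 < D.arg := (Complex.arg_nonneg_iff.2 hD.le).lt_of_ne' fun h =>
    hD.ne' (Complex.arg_eq_zero_iff.1 h).2
  have harg' : D.arg / m < Real.pi :=
    (div_le_self harg.le (Nat.one_le_cast.2 (Nat.pos_of_ne_zero hm))).trans_lt
      ((Complex.arg_le_pi D).lt_of_ne fun h => hD.ne' (Complex.arg_eq_pi_iff.1 h).2)
  have him : (Complex.log D * (m : ℂ)⁻¹).im = D.arg / m := by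
    rw [← Complex.ofReal_natCast, ← Complex.ofReal_inv, Complex.im_mul_ofReal, Complex.log_im,
      div_eq_mul_inv]
  rw [Complex.cpow_def_of_ne_zero hD0, Complex.exp_im, him]
  have hm' : (0 : ℝ) < m := Nat.cast_pos.2 (Nat.pos_of_ne_zero hm)
  exact mul_pos (Real.exp_pos _) (Real.sin_pos_of_pos_of_lt_pi (div_pos harg hm') harg')

variable {F : ℂ × ℂ → ℂ} {B ω : ℂ}

theorem tendsto_sub_div_of_contDiff (hF : ContDiff ℂ 1 F)
    (hB : HasDerivAt (fun t => F (ω, t)) B 0) {ι : Type*} {l : Filter ι} {z t : ι → ℂ}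
    (hz : Tendsto z l (𝓝 ω)) (ht : Tendsto t l (𝓝[≠] 0)) :
    Tendsto (fun i => (F (z i, t i) - F (z i, 0)) / t i) l (𝓝 B) := by
  have hstrict := hF.contDiffAt.hasStrictFDerivAt one_ne_zero (x := (ω, (0 : ℂ)))
  have hB' : fderiv ℂ F (ω, 0) (0, 1) = B := by
    refine HasDerivAt.unique ?_ hB
    exact hstrict.hasFDerivAt.comp_hasDerivAt 0 ((hasDerivAt_const 0 ω).prodMk (hasDerivAt_id 0))
  have hpair : Tendsto (fun i => ((z i, t i), (z i, (0 : ℂ)))) l (𝓝 ((ω, 0), (ω, 0))) :=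
    (hz.prodMk_nhds (tendsto_nhds_of_tendsto_nhdsWithin ht)).prodMk_nhds
      (hz.prodMk_nhds tendsto_const_nhds)
  have hsmall := (hstrict.isLittleO.comp_tendsto hpair).norm_right
  have hlim : Tendsto (fun i => (F (z i, t i) - F (z i, 0) - t i * B) / t i) l (𝓝 0) := by
    refine ((hsmall.congr' (.of_forall fun i => ?_) (.of_forall fun i => ?_)).of_norm_right
      (g' := t)).tendsto_div_nhds_zero
    · have hdiff : ((z i, t i) - (z i, 0) : ℂ × ℂ) = t i • (0, 1) := by simp
      simp only [Function.comp_apply, hdiff, map_smul, hB', smul_eq_mul]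
    · simp [Prod.norm_def]
  have hne : ∀ᶠ i in l, t i ≠ 0 := ht.eventually self_mem_nhdsWithin
  refine (zero_add B ▸ hlim.add_const B).congr' (hne.mono fun i hi => ?_)
  field_simp
  ring

variable {g : ℂ → ℂ} {m : ℕ}

theorem tendsto_rescaled (hF : ContDiff ℂ 1 F) (hB : HasDerivAt (fun t => F (ω, t)) B 0)
    (hg : ContinuousAt g ω) (hm : m ≠ 0) (hfac : ∀ᶠ z in 𝓝 ω, F (z, 0) = (z - ω) ^ m * g z)
    {ι : Type*} {l : Filter ι} {s ζ : ι → ℂ} {ζ₀ : ℂ} (hs : Tendsto s l (𝓝[≠] 0))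
    (hζ : Tendsto ζ l (𝓝 ζ₀)) :
    Tendsto (fun i => F (ω + s i * ζ i, s i ^ m) / s i ^ m) l (𝓝 (ζ₀ ^ m * g ω + B)) := by
  have hs0 : Tendsto s l (𝓝 0) := tendsto_nhds_of_tendsto_nhdsWithin hs
  have hne : ∀ᶠ i in l, s i ≠ 0 := hs.eventually self_mem_nhdsWithin
  have hz : Tendsto (fun i => ω + s i * ζ i) l (𝓝 ω) := by
    simpa using (hs0.mul hζ).const_add ω
  have hsm : Tendsto (fun i => s i ^ m) l (𝓝[≠] 0) :=
    tendsto_nhdsWithin_iff.2 ⟨by simpa [hm] using hs0.pow m, hne.mono fun i hi => pow_ne_zero m hi⟩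
  refine (((hζ.pow m).mul (hg.tendsto.comp hz)).add
    (tendsto_sub_div_of_contDiff hF hB hz hsm)).congr' ?_
  filter_upwards [hz.eventually hfac, hne] with i hi hsi
  simp only [hi, Function.comp_apply, add_sub_cancel_left]
  field_simp
  ring

/-- The zero `ω` of order `m` splits under the perturbation like the roots of `ζ ^ m = -B / g ω`,
at scale `s = t ^ (1 / m)`. -/
theorem eventually_exists_rescaled_zero (hF : ContDiff ℂ 1 F)
    (hB : HasDerivAt (fun t => F (ω, t)) B 0) (hg : ContinuousAt g ω) (hgω : g ω ≠ 0) (hm : m ≠ 0)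
    (hfac : ∀ᶠ z in 𝓝 ω, F (z, 0) = (z - ω) ^ m * g z) {ζ₀ : ℂ} (hζ₀ : ζ₀ ≠ 0)
    (hroot : ζ₀ ^ m * g ω + B = 0) {R : ℝ} (hR : 0 < R) :
    ∀ᶠ s : ℝ in 𝓝[>] 0, ∃ ζ ∈ Metric.ball ζ₀ R, F (ω + s * ζ, (s : ℂ) ^ m) = 0 := by
  set h : ℂ → ℂ := fun ζ => ζ ^ m * g ω + B
  have hcont : Continuous h := by fun_prop
  have hderiv : HasDerivAt h (m * ζ₀ ^ (m - 1) * g ω) ζ₀ :=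
    ((hasDerivAt_pow m ζ₀).mul_const _).add_const _
  have hne : ∀ᶠ ζ in 𝓝[≠] ζ₀, h ζ ≠ 0 := hderiv.eventually_ne
    (mul_ne_zero (mul_ne_zero (Nat.cast_ne_zero.2 hm) (pow_ne_zero _ hζ₀)) hgω)
  obtain ⟨r, ⟨hr, hrR⟩, hrne⟩ := exists_sphere_of_eventually_nhdsNE hne hR
  have hpos : ∀ᶠ s : ℝ in 𝓝[>] 0, 0 < s := self_mem_nhdsWithin
  have hofReal : Tendsto (fun s : ℝ => (s : ℂ)) (𝓝[>] 0) (𝓝[≠] 0) :=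
    tendsto_nhdsWithin_iff.2 ⟨(Complex.continuous_ofReal.tendsto' 0 0 Complex.ofReal_zero).mono_left
      nhdsWithin_le_nhds, hpos.mono fun s hs => Complex.ofReal_ne_zero.2 hs.ne'⟩
  have hunif : TendstoUniformlyOn (fun (s : ℝ) ζ => F (ω + s * ζ, (s : ℂ) ^ m) / (s : ℂ) ^ m) h
      (𝓝[>] 0) (Metric.closedBall ζ₀ r) :=
    tendstoUniformlyOn_of_forall_tendsto (isCompact_closedBall ζ₀ r) hcont.continuousOn fun ζ _ =>
      tendsto_rescaled hF hB hg hm hfac (hofReal.comp tendsto_fst)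
        (tendsto_nhds_of_tendsto_nhdsWithin tendsto_snd)
  have hdiff : ∀ s : ℝ, Differentiable ℂ fun ζ => F (ω + s * ζ, (s : ℂ) ^ m) / (s : ℂ) ^ m :=
    fun s => ((hF.differentiable one_ne_zero).comp (by fun_prop)).div_const _
  filter_upwards [hpos, eventually_exists_zero_of_tendstoUniformlyOn hr
    (.of_forall fun s => (hdiff s).diffContOnCl) hunif hcont.continuousOn hroot hrne]
    with s hs ⟨ζ, hζ, hζ0⟩
  exact ⟨ζ, Metric.closedBall_subset_ball hrR hζ,
    (div_eq_zero_iff.1 hζ0).resolve_right (pow_ne_zero m (Complex.ofReal_ne_zero.2 hs.ne'))⟩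

theorem frequently_exists_zero_im_lt (hF : ContDiff ℂ 1 F)
    (hB : HasDerivAt (fun t => F (ω, t)) B 0) (hg : ContinuousAt g ω) (hgω : g ω ≠ 0) (hm : m ≠ 0)
    (hfac : ∀ᶠ z in 𝓝 ω, F (z, 0) = (z - ω) ^ m * g z) (him : 0 < (-B / g ω).im) {ε : ℝ}
    (hε : 0 < ε) :
    ∃ᶠ t : ℝ in 𝓝[>] 0, ∃ z ∈ Metric.ball ω ε, ω.im < z.im ∧ F (z, t) = 0 := by
  obtain ⟨ζ₀, hζ₀, hζ₀im⟩ := exists_pow_eq_of_im_pos him hm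
  have hζ₀ne : ζ₀ ≠ 0 := by rintro rfl; simp at hζ₀im
  have hroot : ζ₀ ^ m * g ω + B = 0 := by rw [hζ₀]; field_simp; ring
  have hpos : ∀ᶠ s : ℝ in 𝓝[>] 0, 0 < s := self_mem_nhdsWithin
  have hsmall : ∀ᶠ s : ℝ in 𝓝[>] 0, s * (‖ζ₀‖ + ζ₀.im) < ε :=
    ((continuous_id.mul continuous_const).tendsto' 0 0 (zero_mul _)).mono_left
      nhdsWithin_le_nhds |>.eventually_lt_const hε
  have hpow : Tendsto (fun s : ℝ => s ^ m) (𝓝[>] 0) (𝓝[>] 0) := tendsto_nhdsWithin_iff.2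
    ⟨((continuous_pow m).tendsto' 0 0 (zero_pow hm)).mono_left nhdsWithin_le_nhds,
      hpos.mono fun s hs => pow_pos hs m⟩
  refine hpow.frequently (Eventually.frequently ?_)
  filter_upwards [eventually_exists_rescaled_zero hF hB hg hgω hm hfac hζ₀ne hroot hζ₀im, hpos,
    hsmall] with s ⟨ζ, hζ, hζ0⟩ hs hsε
  have hζim : 0 < ζ.im := by
    have := (Complex.abs_im_le_norm _).trans_lt (mem_ball_iff_norm.1 hζ)
    rw [Complex.sub_im] at this
    linarith [neg_lt_of_abs_lt this]
  refine ⟨ω + s * ζ, ?_, ?_, by exact_mod_cast hζ0⟩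
  · rw [mem_ball_iff_norm, add_sub_cancel_left, norm_mul, Complex.norm_of_nonneg hs.le]
    refine lt_of_le_of_lt ?_ hsε
    gcongr
    exact norm_le_of_mem_closedBall (Metric.ball_subset_closedBall hζ)
  · rw [Complex.add_im, Complex.im_ofReal_mul]
    exact lt_add_of_pos_right _ (mul_pos hs hζim)

end Perturbation

section Flux

variable {L K : ℝ} {q : ℝ → ℂ} {n : ℝ → ℝ} {ω : ℂ} {u w : ℝ → ℂ}

theorem flux_const_mul (c : ℂ) (u w : ℝ → ℂ) (x : ℝ) :
    flux (fun y => c * u y) (fun y => c * w y) x = ‖c‖ ^ 2 * flux u w x := by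
  have : conj (c * u x) * (c * w x) = ((‖c‖ ^ 2 : ℝ) : ℂ) * (conj (u x) * w x) := by
    push_cast
    rw [← Complex.conj_mul', map_mul]
    ring
  rw [flux, this, Complex.im_ofReal_mul, flux]

theorem flux_reflect (c : ℝ) (u w : ℝ → ℂ) (x : ℝ) :
    flux (fun y => u (c - y)) (fun y => -w (c - y)) x = -flux u w (c - x) := by
  simp only [flux, mul_neg, Complex.neg_im]

theorem IsOutgoing.flux_zero (hout : IsOutgoing L ω u w) :
    flux u w 0 = -ω.re * ‖u 0‖ ^ 2 := by
  have : conj (u 0) * w 0 = ((‖u 0‖ ^ 2 : ℝ) : ℂ) * -(Complex.I * ω) := by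
    push_cast
    rw [hout.left, ← Complex.conj_mul']
    ring
  rw [flux, this, Complex.im_ofReal_mul, Complex.neg_im, Complex.I_mul_im]
  ring

theorem IsOutgoing.flux_right (hout : IsOutgoing L ω u w) :
    flux u w L = ω.re * ‖u L‖ ^ 2 := by
  have : conj (u L) * w L = ((‖u L‖ ^ 2 : ℝ) : ℂ) * (Complex.I * ω) := by
    push_cast
    rw [hout.right, ← Complex.conj_mul']
    ring
  rw [flux, this, Complex.im_ofReal_mul, Complex.I_mul_im, mul_comm]

theorem sq_im_eq (ω : ℂ) : (ω ^ 2).im = 2 * ω.re * ω.im := by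
  rw [sq, Complex.mul_im]
  ring

theorem IsOutgoing.im_neg (hout : IsOutgoing L ω u w)
    (h : SolvesHelmholtz (permittivity n) ω u w) (hL : 0 < L) (hn : ∀ x, n x ≠ 0)
    (hK : ∀ x, ‖permittivity n x‖ ≤ K) (hu : u ≠ 0) (hω : ω.re ≠ 0) : ω.im < 0 := by
  have henergy := h.energy_pos (ne_of_apply_ne Complex.re hω) hn hK hu hL
  have hflux := h.flux_sub 0 L
  rw [hout.flux_zero, hout.flux_right, sq_im_eq] at hflux
  have hbalance : ‖u 0‖ ^ 2 + ‖u L‖ ^ 2 =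
      -ω.im * (2 * ∫ x in (0 : ℝ)..L, n x ^ 2 * ‖u x‖ ^ 2) :=
    mul_left_cancel₀ hω (by linear_combination hflux)
  have hpos : 0 < ‖u 0‖ ^ 2 + ‖u L‖ ^ 2 := by
    have := norm_pos_iff.2 (hout.left_ne_zero h hK hu)
    positivity
  rw [hbalance] at hpos
  exact neg_pos.1 (pos_of_mul_pos_left hpos (by positivity))

theorem SolvesHelmholtz.strictMono_flux_div (h : SolvesHelmholtz (permittivity n) ω u w)
    (hn : ∀ x, n x ≠ 0) (hK : ∀ x, ‖permittivity n x‖ ≤ K) (hu : u ≠ 0) (hω : ω.re ≠ 0)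
    (him : ω.im < 0) : StrictMono fun x => flux u w x / ω.re := fun a b hab => by
  have henergy := h.energy_pos (ne_of_apply_ne Complex.re hω) hn hK hu hab
  have hflux := h.flux_sub a b
  have hdiff : flux u w b / ω.re - flux u w a / ω.re =
      2 * -ω.im * ∫ x in a..b, n x ^ 2 * ‖u x‖ ^ 2 := by
    rw [← sub_div, hflux, sq_im_eq]
    field_simp
  exact sub_pos.1 (hdiff ▸ mul_pos (mul_pos two_pos (neg_pos.2 him)) henergy)

theorem IsOutgoing.apply_zero_mul (hout : IsOutgoing L ω u w) (h : SolvesHelmholtz q ω u w)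
    (hq : ∀ x, q (L - x) = q x) (hK : ∀ x, ‖q x‖ ≤ K) (x : ℝ) :
    u 0 * u x = u L * u (L - x) :=
  congrFun ((h.const_mul (u 0)).eq_of_eq ((h.reflect hq).const_mul (u L)) hK (c := L)
    (by rw [sub_self, mul_comm]) (by rw [sub_self, hout.left, hout.right]; ring)) x

theorem IsOutgoing.apply_right_sq (hout : IsOutgoing L ω u w) (h : SolvesHelmholtz q ω u w)
    (hq : ∀ x, q (L - x) = q x) (hK : ∀ x, ‖q x‖ ≤ K) : u L ^ 2 = u 0 ^ 2 := by
  have := hout.apply_zero_mul h hq hK 0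
  rw [sub_zero] at this
  rw [sq, sq, this]

theorem IsOutgoing.norm_apply_right (hout : IsOutgoing L ω u w) (h : SolvesHelmholtz q ω u w)
    (hq : ∀ x, q (L - x) = q x) (hK : ∀ x, ‖q x‖ ≤ K) : ‖u L‖ = ‖u 0‖ := by
  rw [← sq_eq_sq₀ (norm_nonneg _) (norm_nonneg _), ← norm_pow, hout.apply_right_sq h hq hK,
    norm_pow]

theorem IsOutgoing.apply_const_sub_sq (hout : IsOutgoing L ω u w) (h : SolvesHelmholtz q ω u w)
    (hq : ∀ x, q (L - x) = q x) (hK : ∀ x, ‖q x‖ ≤ K) (hu : u ≠ 0) (x : ℝ) :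
    u (L - x) ^ 2 = u x ^ 2 :=
  mul_left_cancel₀ (pow_ne_zero 2 (hout.right_ne_zero h hK hu)) <| by
    rw [← mul_pow, ← hout.apply_zero_mul h hq hK, mul_pow, hout.apply_right_sq h hq hK]

theorem IsOutgoing.flux_const_sub (hout : IsOutgoing L ω u w) (h : SolvesHelmholtz q ω u w)
    (hq : ∀ x, q (L - x) = q x) (hK : ∀ x, ‖q x‖ ≤ K) (hu : u ≠ 0) (x : ℝ) :
    flux u w (L - x) = -flux u w x := by
  have hfun : (fun y => u 0 * u y) = fun y => u L * u (L - y) :=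
    funext (hout.apply_zero_mul h hq hK)
  have hderiv : u 0 * w x = u L * -w (L - x) :=
    ((h.const_mul (u 0)).hasDerivAt x).unique
      (hfun ▸ ((h.reflect hq).const_mul (u L)).hasDerivAt x)
  have hflux : ‖u 0‖ ^ 2 * flux u w x = ‖u L‖ ^ 2 * -flux u w (L - x) := by
    rw [← flux_reflect, ← flux_const_mul, ← flux_const_mul, ← hfun]
    simp only [flux, hderiv]
  rw [hout.norm_apply_right h hq hK] at hflux
  have hu0 : ‖u 0‖ ^ 2 ≠ 0 := pow_ne_zero 2 (norm_ne_zero_iff.2 (hout.left_ne_zero h hK hu))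
  rw [mul_left_cancel₀ hu0 hflux, neg_neg]

variable (hout : IsOutgoing L ω u w) (h : SolvesHelmholtz (permittivity n) ω u w)
  (hq : ∀ x, permittivity n (L - x) = permittivity n x) (hn : ∀ x, n x ≠ 0)
  (hK : ∀ x, ‖permittivity n x‖ ≤ K) (hu : u ≠ 0) (hω : ω.re ≠ 0) (hL : 0 < L)
include hout h hq hn hK hu hω hL

theorem IsOutgoing.flux_ne_zero {x : ℝ} (hx : x ≠ L / 2) : flux u w x ≠ 0 := fun h0 => hx <| by
  have hcenter : flux u w (L / 2) = 0 := by
    have := hout.flux_const_sub h hq hK hu (L / 2)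
    rw [sub_half] at this
    linarith
  refine (h.strictMono_flux_div hn hK hu hω (hout.im_neg h hL hn hK hu hω)).injective ?_
  simp only [h0, hcenter]

theorem IsOutgoing.abs_flux_le {x : ℝ} (hx : x ∈ Icc 0 L) :
    |flux u w x| ≤ |ω.re| * ‖u 0‖ ^ 2 := by
  have hmono := (h.strictMono_flux_div hn hK hu hω (hout.im_neg h hL hn hK hu hω)).monotone
  have hle : |flux u w x / ω.re| ≤ ‖u 0‖ ^ 2 := by
    refine abs_le.2 ⟨?_, ?_⟩
    · calc -‖u 0‖ ^ 2 = flux u w 0 / ω.re := by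
            rw [hout.flux_zero, neg_mul, neg_div, mul_div_cancel_left₀ _ hω]
        _ ≤ flux u w x / ω.re := hmono hx.1
    · calc flux u w x / ω.re ≤ flux u w L / ω.re := hmono hx.2
        _ = ‖u 0‖ ^ 2 := by
            rw [hout.flux_right, mul_div_cancel_left₀ _ hω, hout.norm_apply_right h hq hK]
  rwa [abs_div, div_le_iff₀' (abs_pos.2 hω)] at hle

theorem IsOutgoing.exists_isLeast_le {a : ℂ} (ha : a ≠ 0) {α β : ℝ} (hαβ : α < β)
    (hα : α ∈ Icc 0 L) (hβ : β ∈ Icc 0 L) (hcenter : L / 2 ∉ Icc α β)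
    (hα0 : (a * u α ^ 2).im = 0) (hβ0 : (a * u β ^ 2).im = 0) :
    ∃ m : ℝ, IsLeast ((fun y => ‖u y‖ ^ 2) '' Icc α β) m ∧
      m / ‖u 0‖ ^ 2 * (1 / 4) * (2 * Real.pi / |ω.re|) ≤ |β - α| := by
  have hflux : ∀ x ∈ Icc α β, flux u w x ≠ 0 := fun x hx =>
    hout.flux_ne_zero h hq hn hK hu hω hL (ne_of_mem_of_not_mem hx hcenter)
  obtain ⟨t, ht, hmin⟩ := isCompact_Icc.exists_isMinOn (nonempty_Icc.2 hαβ.le)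
    (h.continuous.norm.pow 2).continuousOn
  refine ⟨‖u t‖ ^ 2, ⟨mem_image_of_mem _ ht, forall_mem_image.2 hmin⟩, ?_⟩
  have hut : 0 < ‖u t‖ ^ 2 :=
    pow_pos (norm_pos_iff.2 fun h0 => hflux t ht (by simp [flux, h0])) 2
  have hu0 : 0 < ‖u 0‖ ^ 2 := pow_pos (norm_pos_iff.2 (hout.left_ne_zero h hK hu)) 2
  have hlen := pi_div_two_mul_le h.hasDerivAt h.isPrimitive_deriv.continuous hαβ hflux
    (fun x hx => hout.abs_flux_le h hq hn hK hu hω hL ⟨hα.1.trans hx.1, hx.2.trans hβ.2⟩)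
    ha hα0 hβ0 hut hmin
  rw [abs_of_pos (sub_pos.2 hαβ)]
  calc ‖u t‖ ^ 2 / ‖u 0‖ ^ 2 * (1 / 4) * (2 * Real.pi / |ω.re|)
      = Real.pi / 2 * ‖u t‖ ^ 2 / (|ω.re| * ‖u 0‖ ^ 2) := by field_simp; norm_num
    _ ≤ β - α := (div_le_iff₀ (mul_pos (abs_pos.2 hω) hu0)).2 hlen

end Flux

/-- The index whose square interpolates linearly between the squares of `n` and `n₁`. -/
noncomputable def interpIndex (n n₁ : ℝ → ℝ) (t x : ℝ) : ℝ :=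
  √(n x ^ 2 + t * (n₁ x ^ 2 - n x ^ 2))

section Interpolation

variable {L np t : ℝ} {n n₁ : ℝ → ℝ}

theorem interpIndex_sq (ht : t ∈ Icc (0 : ℝ) 1) (x : ℝ) :
    interpIndex n n₁ t x ^ 2 = n x ^ 2 + t * (n₁ x ^ 2 - n x ^ 2) :=
  Real.sq_sqrt <| by
    have := mul_nonneg (sub_nonneg.2 ht.2) (sq_nonneg (n x))
    linarith [mul_nonneg ht.1 (sq_nonneg (n₁ x))]

theorem permittivity_interpIndex (ht : t ∈ Icc (0 : ℝ) 1) :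
    permittivity (interpIndex n n₁ t) =
      permittivity n + (t : ℂ) • (permittivity n₁ - permittivity n) := by
  funext x
  simp only [permittivity, ← Complex.ofReal_pow, interpIndex_sq ht, Pi.add_apply, Pi.smul_apply,
    Pi.sub_apply, smul_eq_mul]
  push_cast
  rfl

theorem AdmissibleSym.interpIndex_mem (hn : n ∈ AdmissibleSym L 1 np)
    (hn₁ : n₁ ∈ AdmissibleSym L 1 np) (ht : t ∈ Icc (0 : ℝ) 1) :
    interpIndex n n₁ t ∈ AdmissibleSym L 1 np := by
  refine ⟨((hn.1.pow_const 2).add (((hn₁.1.pow_const 2).sub (hn.1.pow_const 2)).const_mul t)).sqrt,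
    fun x hx => ?_, fun x hx => ?_, fun x => ?_⟩
  · have hmem : ∀ m ∈ AdmissibleSym L 1 np, m x ^ 2 ∈ Icc 1 (np ^ 2) := fun m hm =>
      ⟨one_le_pow₀ (hm.2.1 x hx).1,
        pow_le_pow_left₀ (zero_le_one.trans (hm.2.1 x hx).1) (hm.2.1 x hx).2 2⟩
    have hconvex := (convex_Icc 1 (np ^ 2)).add_smul_sub_mem (hmem n hn) (hmem n₁ hn₁) ht
    have hnp : 0 ≤ np := zero_le_one.trans ((hn.2.1 x hx).1.trans (hn.2.1 x hx).2)
    exact ⟨Real.one_le_sqrt.2 hconvex.1, Real.sqrt_le_iff.2 ⟨hnp, hconvex.2⟩⟩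
  · simp only [interpIndex, hn.2.2.1 x hx, hn₁.2.2.1 x hx, sub_self, mul_zero, add_zero, one_pow,
      Real.sqrt_one]
  · simp only [interpIndex, hn.2.2.2 x, hn₁.2.2.2 x]

theorem AdmissibleSym.eLpNorm_interpIndex_sub_le (hn : n ∈ AdmissibleSym L 1 np)
    (hn₁ : n₁ ∈ AdmissibleSym L 1 np) (hL : 0 ≤ L) (ht : t ∈ Icc (0 : ℝ) 1) :
    eLpNorm (fun x => interpIndex n n₁ t x - n x) ⊤ volume ≤ ENNReal.ofReal (t * np ^ 2) := by
  rw [eLpNorm_exponent_top]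
  refine eLpNormEssSup_le_of_ae_bound (Eventually.of_forall fun x => ?_)
  set s := interpIndex n n₁ t x
  have hs := one_le (interpIndex_mem hn hn₁ ht) x
  have hnx := one_le hn x
  have hn₁x := one_le hn₁ x
  have hdiff : |n₁ x ^ 2 - n x ^ 2| ≤ np ^ 2 := by
    have := pow_le_pow_left₀ (zero_le_one.trans hnx) (le hn hL x) 2
    have := pow_le_pow_left₀ (zero_le_one.trans hn₁x) (le hn₁ hL x) 2
    exact abs_le.2 ⟨by linarith [sq_nonneg (n₁ x)], by linarith [sq_nonneg (n x)]⟩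
  calc ‖s - n x‖ ≤ |s - n x| * (s + n x) :=
        le_mul_of_one_le_right (abs_nonneg _) (by linarith)
    _ = |s ^ 2 - n x ^ 2| := by
        rw [← abs_of_nonneg (show 0 ≤ s + n x by linarith), ← abs_mul]
        ring_nf
    _ = t * |n₁ x ^ 2 - n x ^ 2| := by
        rw [interpIndex_sq ht, add_sub_cancel_left, abs_mul, abs_of_nonneg ht.1]
    _ ≤ t * np ^ 2 := mul_le_mul_of_nonneg_left hdiff ht.1

end Interpolation

theorem exists_eventually_eq_pow_mul {f : ℂ → ℂ} (hf : Differentiable ℂ f) {ω z : ℂ}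
    (hω : f ω = 0) (hz : f z ≠ 0) :
    ∃ (m : ℕ) (g : ℂ → ℂ), m ≠ 0 ∧ ContinuousAt g ω ∧ g ω ≠ 0 ∧
      ∀ᶠ y in 𝓝 ω, f y = (y - ω) ^ m * g y := by
  have hana : AnalyticOnNhd ℂ f univ := fun y _ => hf.analyticAt y
  obtain ⟨m, g, hg, hgω, hfac⟩ :=
    (hf.analyticAt ω).exists_eventuallyEq_pow_smul_nonzero_iff.2 fun hev =>
      hz (hana.eqOn_zero_of_preconnected_of_eventuallyEq_zero isPreconnected_univ (mem_univ ω) hev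
        (mem_univ z))
  refine ⟨m, g, ?_, hg.continuousAt, hgω, hfac⟩
  rintro rfl
  have := hfac.self_of_nhds
  rw [hω, pow_zero, one_smul] at this
  exact hgω this.symm

section FirstOrder

variable {L np ρ : ℝ} {n n₁ : ℝ → ℝ} {ω : ℂ} {u w : ℝ → ℂ}

theorem IsResonancePair.im_neg (h : IsResonancePair L n ω u) (hL : 0 < L)
    (hn : n ∈ AdmissibleSym L 1 np) (hω : ω.re ≠ 0) : ω.im < 0 := by
  obtain ⟨w, hw, hout⟩ := h.exists_solvesHelmholtz hL.le hn
  exact hout.im_neg hw hL (AdmissibleSym.ne_zero hn)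
    (AdmissibleSym.norm_permittivity_le hn hL.le) h.nontrivial hω

theorem charFun_one_add_I_ne_zero (hL : 0 < L) (hn : n ∈ AdmissibleSym L 1 np)
    {q : boundedMeasurable} (hq : (q : ℝ → ℂ) = permittivity n) :
    charFun hL.le (1 + Complex.I) q ≠ 0 := fun h => by
  have hre : (1 + Complex.I).re = 1 := by simp
  have him : (1 + Complex.I).im = 1 := by simp
  have hre0 : (1 + Complex.I).re ≠ 0 := hre ▸ one_ne_zero
  obtain ⟨v, hv⟩ :=
    exists_isResonancePair_of_charFun_eq_zero hL.le hn hq (ne_of_apply_ne Complex.re hre0) h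
  exact (him ▸ hv.im_neg hL hn hre0).not_gt one_pos

theorem width_le_of_charFun_eq_zero (hL : 0 ≤ L) (hn : n ∈ AdmissibleSym L 1 np)
    {q : boundedMeasurable} (hq : (q : ℝ → ℂ) = permittivity n) (hω : ω ≠ 0) (hρ : |ω.re| ≤ ρ)
    (h : charFun hL ω q = 0) : width L ρ n ≤ ENNReal.ofReal |ω.im| :=
  iInf₂_le ω ⟨exists_isResonancePair_of_charFun_eq_zero hL hn hq hω h, hρ⟩

theorem IsLocalMinimizer.eventually_width_le (hmin : IsLocalMinimizer L 1 np ρ n) (hL : 0 ≤ L)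
    (hn₁ : n₁ ∈ AdmissibleSym L 1 np) :
    ∀ᶠ t : ℝ in 𝓝[>] 0, t ∈ Icc (0 : ℝ) 1 ∧ width L ρ n ≤ width L ρ (interpIndex n n₁ t) := by
  obtain ⟨hn, ε, hε, hwidth⟩ := hmin
  have hsmall : ∀ᶠ t : ℝ in 𝓝[>] 0, t * np ^ 2 < ε :=
    (((continuous_mul_const (np ^ 2)).tendsto' 0 0 (zero_mul _)).eventually_lt_const hε).filter_mono
      nhdsWithin_le_nhds
  filter_upwards [hsmall, Ioo_mem_nhdsGT one_pos] with t htε ht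
  have ht' := Ioo_subset_Icc_self ht
  exact ⟨ht', hwidth _ (AdmissibleSym.interpIndex_mem hn hn₁ ht')
    ((AdmissibleSym.eLpNorm_interpIndex_sub_le hn hn₁ hL ht').trans_lt
      ((ENNReal.ofReal_lt_ofReal_iff hε).2 htε))⟩

theorem IsLocalMinimizer.exists_forall_charFun_eq_zero_im_le (hmin : IsLocalMinimizer L 1 np ρ n)
    (hL : 0 ≤ L) (hn₁ : n₁ ∈ AdmissibleSym L 1 np) {q q₁ : boundedMeasurable}
    (hq : (q : ℝ → ℂ) = permittivity n) (hq₁ : (q₁ : ℝ → ℂ) = permittivity n₁)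
    (hω : ENNReal.ofReal |ω.im| = width L ρ n) (hρ : |ω.re| < ρ) (him : ω.im < 0) :
    ∃ ε > 0, ∀ᶠ t : ℝ in 𝓝[>] 0, ∀ z ∈ Metric.ball ω ε,
      charFun hL z (q + (t : ℂ) • (q₁ - q)) = 0 → z.im ≤ ω.im := by
  have hnear : ∀ᶠ z in 𝓝 ω, |z.re| < ρ ∧ z.im < 0 :=
    ((Complex.continuous_re.abs.tendsto ω).eventually_lt_const hρ).and
      ((Complex.continuous_im.tendsto ω).eventually_lt_const him)
  obtain ⟨ε, hε, hball⟩ := Metric.eventually_nhds_iff_ball.1 hnear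
  refine ⟨ε, hε, ?_⟩
  filter_upwards [hmin.eventually_width_le hL hn₁] with t ht z hz hzero
  obtain ⟨hzρ, hzim⟩ := hball z hz
  have hwidth := ht.2.trans (width_le_of_charFun_eq_zero (ρ := ρ) hL
    (AdmissibleSym.interpIndex_mem hmin.1 hn₁ ht.1)
    (q := q + (t : ℂ) • (q₁ - q))
    (by rw [permittivity_interpIndex ht.1, ← hq, ← hq₁]; rfl)
    (ne_of_apply_ne Complex.im hzim.ne) hzρ.le hzero)
  rw [← hω, ENNReal.ofReal_le_ofReal_iff (abs_nonneg _), abs_of_neg him, abs_of_neg hzim] at hwidth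
  exact neg_le_neg_iff.1 hwidth

/-- If the integral were positive, a zero of `charFun` would move up from `ω` as `n²` moves towards
`n₁²`, so that the width would decrease. -/
theorem IsLocalMinimizer.exists_forall_integral_nonpos (hmin : IsLocalMinimizer L 1 np ρ n)
    (hL : 0 < L) (hout : IsOutgoing L ω u w) (h : SolvesHelmholtz (permittivity n) ω u w)
    (hu : u ≠ 0) (hω : ENNReal.ofReal |ω.im| = width L ρ n) (hρ : |ω.re| < ρ) (hre : ω.re ≠ 0) :
    ∃ a : ℂ, a ≠ 0 ∧ ∀ n₁ ∈ AdmissibleSym L 1 np,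
      (∫ x in (0 : ℝ)..L, (permittivity n₁ x - permittivity n x) * (a * u x ^ 2)).im ≤ 0 := by
  have hn := hmin.1
  have hK := AdmissibleSym.norm_permittivity_le hn hL.le
  have him := hout.im_neg h hL (AdmissibleSym.ne_zero hn) hK hu hre
  have hω0 : ω ≠ 0 := ne_of_apply_ne Complex.re hre
  have hu0 := hout.left_ne_zero h hK hu
  have huL := hout.right_ne_zero h hK hu
  let q : boundedMeasurable := ⟨permittivity n, AdmissibleSym.permittivity_mem hn hL.le⟩
  have hzero : charFun hL.le ω q = 0 := hout.charFun_eq_zero (q := q) h hL.le huL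
  obtain ⟨m, g, hm, hg, hgω, hfac⟩ :=
    exists_eventually_eq_pow_mul (differentiable_charFun q) hzero
      (charFun_one_add_I_ne_zero hL hn rfl)
  have ha : ω ^ 2 / (u 0 * u L * g ω) ≠ 0 :=
    div_ne_zero (pow_ne_zero 2 hω0) (mul_ne_zero (mul_ne_zero hu0 huL) hgω)
  refine ⟨ω ^ 2 / (u 0 * u L * g ω), ha, fun n₁ hn₁ => ?_⟩
  let q₁ : boundedMeasurable := ⟨permittivity n₁, AdmissibleSym.permittivity_mem hn₁ hL.le⟩
  by_contra! hpos
  have hderiv := hout.hasDerivAt_charFun (q := q) h hL.le hu0 huL (q₁ - q)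
  obtain ⟨ε, hε, hle⟩ :=
    hmin.exists_forall_charFun_eq_zero_im_le hL.le hn₁ (q := q) (q₁ := q₁) rfl rfl hω hρ him
  have hup := frequently_exists_zero_im_lt (contDiff_charFun (hL := hL.le) q (q₁ - q) 1) hderiv hg
    hgω hm (by simpa only [zero_smul, add_zero] using hfac) ?_ hε
  · obtain ⟨t, ⟨z, hz, hlt, hz0⟩, ht⟩ := (hup.and_eventually hle).exists
    exact (ht z hz hz0).not_gt hlt
  · refine hpos.trans_eq (congrArg Complex.im ?_)
    simp only [mul_left_comm _ (ω ^ 2 / (u 0 * u L * g ω)), intervalIntegral.integral_const_mul]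
    change _ = -(-ω ^ 2 / (u 0 * u L) *
      ∫ x in (0 : ℝ)..L, (permittivity n₁ x - permittivity n x) * u x ^ 2) / g ω
    field_simp

end FirstOrder

open Classical in
/-- The structure taking the value `np` where `G` is positive on `[0, L]`, and `1` elsewhere. -/
noncomputable def bangBang (L np : ℝ) (G : ℝ → ℝ) (x : ℝ) : ℝ :=
  if x ∈ Icc 0 L ∧ 0 < G x then np else 1

section BangBang

variable {L np ρ x : ℝ} {n n₁ G : ℝ → ℝ} {ω : ℂ} {u w f : ℝ → ℂ}

theorem bangBang_mem (hnp : 1 ≤ np) (hG : Measurable G) (hsymm : ∀ x, G (L - x) = G x) :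
    bangBang L np G ∈ AdmissibleSym L 1 np := by
  refine ⟨.ite (measurableSet_Icc.inter (measurableSet_lt measurable_const hG)) measurable_const
    measurable_const, fun x _ => ?_, fun x hx => if_neg fun h => hx h.1, fun x => ?_⟩
  · unfold bangBang
    split_ifs
    exacts [⟨hnp, le_rfl⟩, ⟨le_rfl, hnp⟩]
  · have hx : L - x ∈ Icc 0 L ↔ x ∈ Icc 0 L := by
      rw [sub_mem_Icc_iff_right, sub_self, sub_zero]
    simp only [bangBang, hx, hsymm]

theorem AdmissibleSym.bangBang_sq_sub_sq_mul_nonneg (hn : n ∈ AdmissibleSym L 1 np)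
    (hx : x ∈ Icc 0 L) : 0 ≤ (bangBang L np G x ^ 2 - n x ^ 2) * G x := by
  obtain ⟨h1, hnp⟩ := hn.2.1 x hx
  have h0 := zero_le_one.trans h1
  unfold bangBang
  split_ifs with h
  · exact mul_nonneg (sub_nonneg.2 (pow_le_pow_left₀ h0 hnp 2)) h.2.le
  · exact mul_nonneg_of_nonpos_of_nonpos (sub_nonpos.2 (pow_le_pow_left₀ zero_le_one h1 2))
      (not_lt.1 fun hG => h ⟨hx, hG⟩)

theorem AdmissibleSym.eq_bangBang (hn : n ∈ AdmissibleSym L 1 np) (hnp : 1 ≤ np) (hG : G x ≠ 0)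
    (h : (bangBang L np G x ^ 2 - n x ^ 2) * G x = 0) : n x = bangBang L np G x := by
  have hbb : 0 ≤ bangBang L np G x := by
    unfold bangBang
    split_ifs
    exacts [zero_le_one.trans hnp, zero_le_one]
  have hsq := sub_eq_zero.1 ((mul_eq_zero.1 h).resolve_right hG)
  exact ((sq_eq_sq₀ hbb (zero_le_one.trans (one_le hn x))).1 hsq).symm

theorem AdmissibleSym.ae_eq_bangBang (hn : n ∈ AdmissibleSym L 1 np) (hL : 0 ≤ L) (hnp : 1 ≤ np)
    (hfin : {x ∈ Icc 0 L | G x = 0}.Finite)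
    (hint : IntervalIntegrable (fun x => (bangBang L np G x ^ 2 - n x ^ 2) * G x) volume 0 L)
    (hle : ∫ x in (0 : ℝ)..L, (bangBang L np G x ^ 2 - n x ^ 2) * G x ≤ 0) :
    n =ᵐ[volume] bangBang L np G := by
  have hnonneg : ∀ x ∈ Icc 0 L, 0 ≤ (bangBang L np G x ^ 2 - n x ^ 2) * G x := fun x hx =>
    bangBang_sq_sub_sq_mul_nonneg hn hx
  have hzero := (intervalIntegral.integral_eq_zero_iff_of_le_of_nonneg_ae hL
    (ae_restrict_of_forall_mem measurableSet_Ioc fun x hx => hnonneg x (Ioc_subset_Icc_self hx))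
    hint).1 (hle.antisymm (intervalIntegral.integral_nonneg hL hnonneg))
  rw [restrict_Ioc_eq_restrict_Icc, EventuallyEq, ae_restrict_iff' measurableSet_Icc] at hzero
  filter_upwards [hzero, compl_mem_ae_iff.2 (hfin.measure_zero volume)] with x hx hG
  by_cases hxI : x ∈ Icc 0 L
  · exact eq_bangBang hn hnp (fun h0 => hG ⟨hxI, h0⟩) (hx hxI)
  · rw [hn.2.2.1 x hxI, bangBang, if_neg fun h => hxI h.1]

theorem AdmissibleSym.intervalIntegrable_permittivity_sub_mul (hn : n ∈ AdmissibleSym L 1 np)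
    (hn₁ : n₁ ∈ AdmissibleSym L 1 np) (hL : 0 ≤ L) (hf : Continuous f) :
    IntervalIntegrable (fun x => (permittivity n₁ x - permittivity n x) * f x) volume 0 L :=
  intervalIntegrable_mul_of_mem_boundedMeasurable
    (sub_mem (permittivity_mem hn₁ hL) (permittivity_mem hn hL)) (hf.intervalIntegrable 0 L)

theorem im_permittivity_sub_mul (x : ℝ) (z : ℂ) :
    ((permittivity n₁ x - permittivity n x) * z).im = (n₁ x ^ 2 - n x ^ 2) * z.im := by
  simp only [permittivity, ← Complex.ofReal_pow, ← Complex.ofReal_sub, Complex.im_ofReal_mul]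

theorem IsLocalMinimizer.exists_ae_eq_bangBang (hmin : IsLocalMinimizer L 1 np ρ n) (hL : 0 < L)
    (hnp : 1 ≤ np) (hout : IsOutgoing L ω u w) (h : SolvesHelmholtz (permittivity n) ω u w)
    (hu : u ≠ 0) (hω : ENNReal.ofReal |ω.im| = width L ρ n) (hρ : |ω.re| < ρ) (hre : ω.re ≠ 0) :
    ∃ a : ℂ, a ≠ 0 ∧ {x ∈ Icc 0 L | (a * u x ^ 2).im = 0}.Finite ∧
      n =ᵐ[volume] bangBang L np fun x => (a * u x ^ 2).im := by
  have hn := hmin.1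
  have hK := AdmissibleSym.norm_permittivity_le hn hL.le
  have him := hout.im_neg h hL (AdmissibleSym.ne_zero hn) hK hu hre
  have hω2 : (ω ^ 2).im ≠ 0 := by
    rw [sq_im_eq]
    exact mul_ne_zero (mul_ne_zero two_ne_zero hre) him.ne
  obtain ⟨a, ha, hle⟩ := hmin.exists_forall_integral_nonpos hL hout h hu hω hρ hre
  have hfin := h.finite_im_mul_sq_eq_zero hω2 (AdmissibleSym.ne_zero hn) hK hu ha
    (isCompact_Icc (a := 0) (b := L))
  have hcont : Continuous fun x => a * u x ^ 2 := continuous_const.mul (h.continuous.pow 2)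
  have hbb : bangBang L np (fun x => (a * u x ^ 2).im) ∈ AdmissibleSym L 1 np :=
    bangBang_mem hnp (Complex.continuous_im.comp hcont).measurable fun x => by
      rw [hout.apply_const_sub_sq h (AdmissibleSym.permittivity_reflect hn) hK hu x]
  have hint := AdmissibleSym.intervalIntegrable_permittivity_sub_mul hn hbb hL.le hcont
  refine ⟨a, ha, hfin, AdmissibleSym.ae_eq_bangBang hn hL.le hnp hfin ?_ ?_⟩
  · have hint_im := intervalIntegrable_iff.2 (intervalIntegrable_iff.1 hint).im
    simpa only [RCLike.im_eq_complex_im, im_permittivity_sub_mul] using hint_im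
  · have hcomm := Complex.imCLM.intervalIntegral_comp_comm hint
    simp only [Complex.imCLM_apply, im_permittivity_sub_mul] at hcomm
    exact hcomm.trans_le (hle _ hbb)

end BangBang

/-- The points near which `f` is not almost everywhere constant: the discontinuities which remain
after any modification of `f` on a null set. -/
def jumpSet {α : Type*} (f : ℝ → α) : Set ℝ :=
  {p | ¬∃ c, ∀ᶠ y in 𝓝 p ⊓ ae volume, f y = c}

section JumpSet

variable {α β : Type*} {f g : ℝ → α} {p L : ℝ} {s : Set ℝ} {P Q : ℝ → Prop}

theorem neBot_nhdsWithin_inf_ae (hs : IsOpen s) (hp : p ∈ closure s) :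
    (𝓝[s] p ⊓ ae volume).NeBot := by
  refine inf_neBot_iff.2 fun t ht t' ht' => ?_
  obtain ⟨u, hu, hpu, hut⟩ := mem_nhdsWithin.1 ht
  obtain ⟨y, hy, hyu⟩ := (Measure.dense_of_ae (p := (· ∈ t')) ht').exists_mem_open (hu.inter hs)
    (mem_closure_iff.1 hp u hu hpu)
  exact ⟨y, hut hyu, hy⟩

theorem neBot_nhds_inf_ae (p : ℝ) : (𝓝 p ⊓ ae volume).NeBot := by
  rw [← nhdsWithin_univ]
  exact neBot_nhdsWithin_inf_ae isOpen_univ (subset_closure (mem_univ p))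

theorem eventually_nhds_inf_ae :
    (∀ᶠ y in 𝓝 p ⊓ ae volume, P y) ↔ ∃ U, IsOpen U ∧ p ∈ U ∧ ∀ᵐ y, y ∈ U → P y := by
  refine eventually_inf.trans ⟨fun ⟨t, ht, t', ht', h⟩ => ?_, fun ⟨U, hU, hpU, h⟩ =>
    ⟨U, hU.mem_nhds hpU, _, h, fun y hy => hy.2 hy.1⟩⟩
  obtain ⟨U, hUt, hU, hpU⟩ := mem_nhds_iff.1 ht
  exact ⟨U, hU, hpU, mem_of_superset ht' fun y hy hyU => h y ⟨hUt hyU, hy⟩⟩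

theorem nhds_inf_ae (p : ℝ) :
    𝓝 p ⊓ ae volume = 𝓝[<] p ⊓ ae volume ⊔ 𝓝[>] p ⊓ ae volume := by
  have hne : ae volume ≤ 𝓟 {p}ᶜ := le_principal_iff.2 (compl_mem_ae_iff.2 (measure_singleton p))
  rw [← inf_sup_right, nhdsLT_sup_nhdsGT, nhdsWithin, inf_assoc, inf_eq_right.2 hne]

theorem mem_jumpSet_iff_ne {c d : α} (hc : ∀ᶠ y in 𝓝[<] p ⊓ ae volume, f y = c)
    (hd : ∀ᶠ y in 𝓝[>] p ⊓ ae volume, f y = d) : p ∈ jumpSet f ↔ c ≠ d := by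
  have := neBot_nhdsWithin_inf_ae isOpen_Iio (p := p) (closure_Iio p ▸ self_mem_Iic)
  have := neBot_nhdsWithin_inf_ae isOpen_Ioi (p := p) (closure_Ioi p ▸ self_mem_Ici)
  refine not_iff_not.1 (not_not.trans ⟨fun ⟨b, hb⟩ => ?_, fun h => ⟨d, ?_⟩⟩)
  · rw [nhds_inf_ae, eventually_sup] at hb
    obtain ⟨y, hyc, hyb⟩ := (hc.and hb.1).exists
    obtain ⟨z, hzd, hzb⟩ := (hd.and hb.2).exists
    exact not_not.2 (hyc.symm.trans (hyb.trans (hzb.symm.trans hzd)))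
  · rw [nhds_inf_ae, eventually_sup]
    exact ⟨not_not.1 h ▸ hc, hd⟩

theorem jumpSet_congr_ae (h : f =ᵐ[volume] g) : jumpSet f = jumpSet g := by
  ext p
  have : ∀ c, (∀ᶠ y in 𝓝 p ⊓ ae volume, f y = c) ↔ ∀ᶠ y in 𝓝 p ⊓ ae volume, g y = c := fun c =>
    eventually_congr ((h.filter_mono inf_le_right).mono fun y hy => by rw [hy])
  simp only [jumpSet, mem_ofPred_eq, this]

theorem jumpSet_comp_of_injective {φ : α → β} (hφ : φ.Injective) :
    jumpSet (fun y => φ (f y)) = jumpSet f := by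
  ext p
  have := neBot_nhds_inf_ae p
  refine not_iff_not.2 ⟨fun ⟨c, hc⟩ => ?_, fun ⟨c, hc⟩ => ⟨φ c, hc.mono fun y => congrArg φ⟩⟩
  obtain ⟨z, hz⟩ := hc.exists
  exact ⟨f z, hc.mono fun y hy => hφ (hy.trans hz.symm)⟩

theorem notMem_jumpSet_of_eventually {c : α} (h : ∀ᶠ y in 𝓝 p, f y = c) : p ∉ jumpSet f :=
  not_not.2 ⟨c, h.filter_mono inf_le_left⟩

theorem jumpSet_subset_of_isClosed (hs : IsClosed s) (hP : ∀ y, P y → y ∈ s) : jumpSet P ⊆ s :=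
  fun p hp => by
    by_contra hps
    exact notMem_jumpSet_of_eventually (c := False)
      ((hs.isOpen_compl.eventually_mem hps).mono fun y hy => eq_false fun h => hy (hP y h)) hp

theorem const_sub_mem_jumpSet (hf : ∀ y, f (L - y) = f y) (hp : p ∈ jumpSet f) :
    L - p ∈ jumpSet f := by
  rintro ⟨c, hc⟩
  have htendsto : Tendsto (L - ·) (𝓝 p ⊓ ae volume) (𝓝 (L - p) ⊓ ae volume) :=
    ((continuous_const.sub continuous_id).tendsto p).inf
      (Measure.measurePreserving_sub_left volume L).quasiMeasurePreserving.tendsto_ae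
  exact hp ⟨c, (htendsto.eventually hc).mono fun y hy => (hf y).symm.trans hy⟩

theorem exists_ae_eq_of_isPreconnected (hs : IsPreconnected s) (hf : Disjoint s (jumpSet f)) :
    ∃ c, ∀ᵐ y, y ∈ s → f y = c := by
  obtain rfl | ⟨p, hp⟩ := s.eq_empty_or_nonempty
  · exact ⟨f 0, Eventually.of_forall fun y => False.elim⟩
  have hconst : ∀ q ∈ s, ∃ c, ∀ᶠ y in 𝓝 q ⊓ ae volume, f y = c := fun q hq =>
    not_not.1 (hf.notMem_of_mem_left hq)
  obtain ⟨c, hc⟩ := hconst p hp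
  have hsub : s ⊆ {q | ∀ᶠ y in 𝓝 q ⊓ ae volume, f y = c} := by
    refine hs.subset_of_closure_inter_subset (isOpen_iff_mem_nhds.2 fun q hq => ?_) ⟨p, hp, hc⟩ ?_
    · obtain ⟨U, hU, hqU, hUc⟩ := eventually_nhds_inf_ae.1 hq
      filter_upwards [hU.mem_nhds hqU] with r hr
      exact eventually_nhds_inf_ae.2 ⟨U, hU, hr, hUc⟩
    · rintro q ⟨hqc, hq⟩
      obtain ⟨d, hd⟩ := hconst q hq
      obtain ⟨U, hU, hqU, hUd⟩ := eventually_nhds_inf_ae.1 hd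
      obtain ⟨r, hrU, hrc : ∀ᶠ y in 𝓝 r ⊓ ae volume, f y = c⟩ :=
        mem_closure_iff.1 hqc U hU hqU
      have := neBot_nhds_inf_ae r
      obtain ⟨y, hyc, hyd⟩ := (hrc.and (eventually_nhds_inf_ae.2 ⟨U, hU, hrU, hUd⟩)).exists
      exact hd.mono fun z hz => hz.trans (hyd.symm.trans hyc)
  refine ⟨c, measure_null_of_locally_null {y | ¬(y ∈ s → f y = c)} fun q hq => ?_⟩
  obtain ⟨U, hU, hqU, hUc⟩ := eventually_nhds_inf_ae.1 (hsub (Classical.not_imp.1 hq).1)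
  refine ⟨_, inter_mem_nhdsWithin _ (hU.mem_nhds hqU), measure_mono_null ?_ hUc⟩
  exact fun y hy h => hy.1 fun _ => h hy.2

theorem exists_eventually_nhdsGT_eq (hf : (jumpSet f).Finite) (p : ℝ) :
    ∃ c, ∀ᶠ y in 𝓝[>] p ⊓ ae volume, f y = c := by
  have hmem : (jumpSet f \ {p})ᶜ ∈ 𝓝 p := hf.sdiff.isClosed.isOpen_compl.mem_nhds fun h => h.2 rfl
  obtain ⟨q, hq, hsub⟩ :=
    mem_nhdsGT_iff_exists_Ioo_subset.1 (inter_mem_nhdsWithin (Ioi p) hmem)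
  obtain ⟨c, hc⟩ := exists_ae_eq_of_isPreconnected (f := f) (isPreconnected_Ioo (a := p) (b := q))
    (disjoint_left.2 fun y hy hyf => (hsub hy).2 ⟨hyf, hy.1.ne'⟩)
  exact ⟨c, eventually_inf.2 ⟨_, Ioo_mem_nhdsGT hq, _, hc, fun y hy => hy.2 hy.1⟩⟩

theorem exists_eventually_nhdsLT_eq (hf : (jumpSet f).Finite) (p : ℝ) :
    ∃ c, ∀ᶠ y in 𝓝[<] p ⊓ ae volume, f y = c := by
  have hmem : (jumpSet f \ {p})ᶜ ∈ 𝓝 p := hf.sdiff.isClosed.isOpen_compl.mem_nhds fun h => h.2 rfl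
  obtain ⟨q, hq, hsub⟩ :=
    mem_nhdsLT_iff_exists_Ioo_subset.1 (inter_mem_nhdsWithin (Iio p) hmem)
  obtain ⟨c, hc⟩ := exists_ae_eq_of_isPreconnected (f := f) (isPreconnected_Ioo (a := q) (b := p))
    (disjoint_left.2 fun y hy hyf => (hsub hy).2 ⟨hyf, hy.2.ne⟩)
  exact ⟨c, eventually_inf.2 ⟨_, Ioo_mem_nhdsLT hq, _, hc, fun y hy => hy.2 hy.1⟩⟩

theorem exists_ae_iff_eq_of_jumpSet_eq (hP : (jumpSet P).Finite) (hPQ : jumpSet P = jumpSet Q) :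
    ∃ c : Prop, ∀ᵐ y, (P y ↔ Q y) = c := by
  have hempty : jumpSet (fun y => P y ↔ Q y) = ∅ := eq_empty_of_forall_notMem fun p => by
    obtain ⟨c, hc⟩ := exists_eventually_nhdsLT_eq hP p
    obtain ⟨d, hd⟩ := exists_eventually_nhdsGT_eq hP p
    obtain ⟨c', hc'⟩ := exists_eventually_nhdsLT_eq (hPQ ▸ hP) p
    obtain ⟨d', hd'⟩ := exists_eventually_nhdsGT_eq (hPQ ▸ hP) p
    have hne : c ≠ d ↔ c' ≠ d' := by
      rw [← mem_jumpSet_iff_ne hc hd, hPQ, mem_jumpSet_iff_ne hc' hd']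
    rw [mem_jumpSet_iff_ne (hc.and hc' |>.mono fun y hy => congrArg₂ Iff hy.1 hy.2)
      (hd.and hd' |>.mono fun y hy => congrArg₂ Iff hy.1 hy.2)]
    simp only [ne_eq, eq_iff_iff] at hne ⊢
    tauto
  simpa only [mem_univ, true_imp_iff] using
    exists_ae_eq_of_isPreconnected isPreconnected_univ (hempty ▸ disjoint_empty univ)

end JumpSet

section Parity

variable {J : Finset ℝ} {P : ℝ → Prop} {L y : ℝ} {N j : ℕ} {x : ℕ → ℝ}

theorem eventually_nhdsLT_filter_lt_eq (J : Finset ℝ) (p : ℝ) :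
    ∀ᶠ y in 𝓝[<] p, ({q ∈ J | q < y} : Finset ℝ) = {q ∈ J | q < p} := by
  have h : ∀ᶠ y in 𝓝[<] p, ∀ q ∈ J, q < p → q < y := (Finset.eventually_all J).2 fun q _ => by
    by_cases hq : q < p
    · exact ((eventually_gt_nhds hq).filter_mono nhdsWithin_le_nhds).mono fun y hy _ => hy
    · exact Eventually.of_forall fun y h => (hq h).elim
  filter_upwards [h, self_mem_nhdsWithin] with y hy hyp
  exact Finset.filter_congr fun q hq => ⟨fun h => h.trans hyp, hy q hq⟩

theorem eventually_nhdsGT_filter_lt_eq (J : Finset ℝ) (p : ℝ) :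
    ∀ᶠ y in 𝓝[>] p, ({q ∈ J | q < y} : Finset ℝ) = {q ∈ J | q ≤ p} := by
  have h : ∀ᶠ y in 𝓝[>] p, ∀ q ∈ J, p < q → y < q := (Finset.eventually_all J).2 fun q _ => by
    by_cases hq : p < q
    · exact ((eventually_lt_nhds hq).filter_mono nhdsWithin_le_nhds).mono fun y hy _ => hy
    · exact Eventually.of_forall fun y h => (hq h).elim
  filter_upwards [h, self_mem_nhdsWithin] with y hy hyp
  exact Finset.filter_congr fun q hq =>
    ⟨fun hqy => not_lt.1 fun hpq => (hy q hq hpq).not_gt hqy, fun hqp => hqp.trans_lt hyp⟩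

theorem jumpSet_odd_card_filter_lt (J : Finset ℝ) :
    jumpSet (fun y => Odd #{q ∈ J | q < y}) = J := by
  ext p
  rw [mem_jumpSet_iff_ne
    ((eventually_nhdsLT_filter_lt_eq J p).filter_mono inf_le_left |>.mono fun y hy => by rw [hy])
    ((eventually_nhdsGT_filter_lt_eq J p).filter_mono inf_le_left |>.mono fun y hy => by rw [hy]),
    Finset.mem_coe]
  by_cases hp : p ∈ J
  · have hinsert : ({q ∈ J | q ≤ p} : Finset ℝ) = insert p {q ∈ J | q < p} := by
      ext q
      simp only [Finset.mem_filter, Finset.mem_insert, le_iff_eq_or_lt]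
      constructor
      · tauto
      · rintro (rfl | h)
        exacts [⟨hp, Or.inl rfl⟩, ⟨h.1, Or.inr h.2⟩]
    rw [hinsert, Finset.card_insert_of_notMem (by simp)]
    simp only [hp, iff_true, ne_eq, eq_iff_iff, Nat.odd_add_one]
    tauto
  · have heq : ({q ∈ J | q ≤ p} : Finset ℝ) = {q ∈ J | q < p} :=
      Finset.filter_congr fun q hq => le_iff_lt_or_eq.trans
        (or_iff_left fun h : q = p => hp (h ▸ hq))
    simp [hp, heq]

theorem ae_iff_odd_card_filter_lt (hP : ∀ y, P y → y ∈ Icc 0 L) (hJ : jumpSet P = J) :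
    ∀ᵐ y, P y ↔ Odd #{q ∈ J | q < y} := by
  obtain ⟨c, hc⟩ := exists_ae_iff_eq_of_jumpSet_eq (hJ ▸ J.finite_toSet)
    (hJ.trans (jumpSet_odd_card_filter_lt J).symm)
  have hJ0 : ∀ q ∈ J, 0 ≤ q := fun q hq =>
    (jumpSet_subset_of_isClosed isClosed_Icc hP (hJ ▸ hq)).1
  obtain ⟨z, hzc, hz⟩ := (Measure.dense_of_ae hc).exists_mem_open isOpen_Iio
    ⟨-1, mem_Iio.2 (neg_one_lt_zero (R := ℝ))⟩
  have hempty : ({q ∈ J | q < z} : Finset ℝ) = ∅ :=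
    Finset.filter_eq_empty_iff.2 fun q hq => (hz.trans_le (hJ0 q hq)).not_gt
  have hPz : ¬P z := fun h => (hP z h).1.not_gt hz
  simp only [mem_ofPred_eq, hempty, hPz, Finset.card_empty, Nat.not_odd_zero, iff_self] at hzc
  exact hc.mono fun y hy => of_eq_true (hy.trans hzc.symm)

theorem even_card_of_jumpSet_eq (hP : ∀ y, P y → y ∈ Icc 0 L) (hJ : jumpSet P = J) :
    Even #J := by
  have hJL : ∀ q ∈ J, q ≤ L := fun q hq =>
    (jumpSet_subset_of_isClosed isClosed_Icc hP (hJ ▸ hq)).2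
  obtain ⟨z, hzP, hz⟩ := (Measure.dense_of_ae (ae_iff_odd_card_filter_lt hP hJ)).exists_mem_open
    isOpen_Ioi ⟨L + 1, lt_add_one L⟩
  have hfull : ({q ∈ J | q < z} : Finset ℝ) = J :=
    Finset.filter_true_of_mem fun q hq => (hJL q hq).trans_lt hz
  rw [mem_ofPred_eq, hfull] at hzP
  exact Nat.not_odd_iff_even.1 fun h => (hP z (hzP.2 h)).2.not_gt hz

theorem exists_strictMonoOn_image_range_eq (J : Finset ℝ) :
    ∃ x : ℕ → ℝ, StrictMonoOn x (Iio #J) ∧ (Finset.range #J).image x = J := by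
  refine ⟨fun i => if h : i < #J then J.orderEmbOfFin rfl ⟨i, h⟩ else 0, fun i hi k hk hik => ?_,
    ?_⟩
  · simpa [mem_Iio.1 hi, mem_Iio.1 hk] using hik
  · ext q
    rw [← Finset.mem_coe (s := J), ← Finset.range_orderEmbOfFin J rfl]
    simp only [Finset.mem_image, Finset.mem_range]
    constructor
    · rintro ⟨i, hi, rfl⟩
      exact ⟨⟨i, hi⟩, by simp [hi]⟩
    · rintro ⟨i, rfl⟩
      exact ⟨i, i.2, by simp⟩

theorem lt_card_filter_image_iff (hx : StrictMonoOn x (Iic N)) (hj : j ≤ N) :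
    j < #{q ∈ (Finset.range (N + 1)).image x | q < y} ↔ x j < y := by
  have hinj : InjOn x (Finset.range (N + 1)) := hx.injOn.mono fun i hi =>
    Nat.lt_succ_iff.1 (Finset.mem_range.1 hi)
  rw [Finset.filter_image,
    Finset.card_image_of_injOn (hinj.mono (Finset.coe_subset.2 (Finset.filter_subset _ _)))]
  constructor
  · intro h
    by_contra hy
    refine h.not_ge ((Finset.card_le_card fun i hi => ?_).trans_eq (Finset.card_range j))
    simp only [Finset.mem_filter, Finset.mem_range] at hi ⊢
    exact (hx.lt_iff_lt (Nat.lt_succ_iff.1 hi.1) hj).1 (hi.2.trans_le (not_lt.1 hy))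
  · intro h
    refine (Finset.card_range (j + 1)).symm.trans_le (Finset.card_le_card fun i hi => ?_)
    simp only [Finset.mem_filter, Finset.mem_range] at hi ⊢
    exact ⟨by omega, ((hx.le_iff_le (show i ≤ N by omega) hj).2 (Nat.lt_succ_iff.1 hi)).trans_lt h⟩

theorem exists_even_mem_Ioo_iff (hx : StrictMonoOn x (Iic N)) (hN : Odd N)
    (hy : y ∉ x '' Iic N) :
    (∃ j, j < N ∧ Even j ∧ y ∈ Ioo (x j) (x (j + 1))) ↔
      Odd #{q ∈ (Finset.range (N + 1)).image x | q < y} := by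
  set k := #{q ∈ (Finset.range (N + 1)).image x | q < y}
  have hkN : k ≤ N + 1 := (Finset.card_filter_le _ _).trans
    (Finset.card_image_le.trans_eq (Finset.card_range _))
  have hlt : ∀ j ≤ N, (x j < y ↔ j < k) := fun j hj => (lt_card_filter_image_iff hx hj).symm
  have hgt : ∀ j ≤ N, (y < x j ↔ k ≤ j) := fun j hj => by
    rw [← not_lt (b := k), ← hlt j hj, not_lt]
    exact ⟨le_of_lt, fun h => h.lt_of_ne fun h' => hy ⟨j, hj, h'.symm⟩⟩
  constructor
  · rintro ⟨j, hj, heven, hjy, hyj⟩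
    have hk1 := (hlt j hj.le).1 hjy
    have hk2 := (hgt (j + 1) hj).1 hyj
    exact (show k = j + 1 by omega) ▸ heven.add_one
  · rintro ⟨i, hi⟩
    obtain ⟨l, hl⟩ := hN
    exact ⟨2 * i, by omega, even_two_mul i, (hlt _ (by omega)).2 (by omega),
      (hgt _ (by omega)).2 (by omega)⟩

end Parity

section Transitions

variable {P : ℝ → Prop} {n G : ℝ → ℝ} {L np : ℝ} {N j : ℕ} {x : ℕ → ℝ}

theorem jumpSet_ite [DecidablePred P] (hnp : np ≠ 1) :
    jumpSet (fun y => if P y then np else 1) = jumpSet P := by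
  have hinj : Function.Injective fun p : Prop => open Classical in if p then np else 1 := by
    intro p q h
    by_cases hp : p <;> by_cases hq : q <;> simp_all
  rw [← jumpSet_comp_of_injective hinj]
  congr!

theorem stepIndex_ae_eq (hN : Odd N) (hx : StrictMonoOn x (Iic N)) :
    stepIndex np N x =ᵐ[volume] fun y =>
      if Odd #{q ∈ (Finset.range (N + 1)).image x | q < y} then np else 1 := by
  filter_upwards [((finite_Iic N).image x).countable.ae_notMem volume] with y hy
  simp only [stepIndex, exists_even_mem_Ioo_iff hx hN hy]

theorem exists_isTransitionSeq [DecidablePred P] (hP : ∀ y, P y → y ∈ Icc 0 L)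
    (hfin : (jumpSet P).Finite) (hn : n =ᵐ[volume] fun y => if P y then np else 1)
    (hone : ¬n =ᵐ[volume] 1) : ∃ (N : ℕ) (x : ℕ → ℝ), IsTransitionSeq L np n N x := by
  set J := hfin.toFinset
  have hJ : jumpSet P = J := hfin.coe_toFinset.symm
  have hae := ae_iff_odd_card_filter_lt hP hJ
  obtain ⟨x, hx, hxJ⟩ := exists_strictMonoOn_image_range_eq J
  have hJpos : 0 < #J := Finset.card_pos.2 <| Finset.nonempty_iff_ne_empty.2 fun hempty =>
    hone <| by
      filter_upwards [hn, hae] with y hy hPy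
      simp_all
  obtain ⟨N, hN⟩ := Nat.exists_eq_add_one.2 hJpos
  have hodd : Odd N := Nat.not_even_iff_odd.1
    (Nat.even_add_one.1 (hN ▸ even_card_of_jumpSet_eq hP hJ))
  rw [hN] at hx hxJ
  have hmono : StrictMonoOn x (Iic N) := hx.mono fun i hi => Nat.lt_succ_of_le hi
  refine ⟨N, x, hodd, hmono, fun j hj => ?_, ?_⟩
  · refine jumpSet_subset_of_isClosed isClosed_Icc hP (hJ ▸ hxJ ▸ ?_)
    exact Finset.mem_coe.2 (Finset.mem_image_of_mem x (Finset.mem_range_succ_iff.2 hj))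
  · filter_upwards [hn, hae, stepIndex_ae_eq (np := np) hodd hmono] with y hy hPy hstep
    rw [hy, hstep, hxJ]
    simp only [hPy]

theorem jumpSet_mem_Icc_and_pos_subset (hG : Continuous G) :
    jumpSet (fun y => y ∈ Icc 0 L ∧ 0 < G y) ⊆ {0, L} ∪ {y ∈ Icc 0 L | G y = 0} := by
  refine fun p hp => by_contra fun hmem => ?_
  simp only [mem_union, mem_insert_iff, mem_singleton_iff, mem_ofPred_eq, not_or, not_and] at hmem
  obtain ⟨⟨hp0, hpL⟩, hpG⟩ := hmem
  by_cases hpI : p ∈ Icc 0 L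
  · have hI : ∀ᶠ y in 𝓝 p, y ∈ Icc 0 L :=
      Icc_mem_nhds (hpI.1.lt_of_ne' hp0) (hpI.2.lt_of_ne hpL)
    obtain hneg | hpos := lt_or_gt_of_ne (hpG hpI)
    · exact notMem_jumpSet_of_eventually (c := False)
        ((hG.continuousAt.eventually_lt_const hneg).mono fun y hy =>
          eq_false fun h => hy.not_gt h.2) hp
    · exact notMem_jumpSet_of_eventually (c := True)
        ((hI.and (hG.continuousAt.eventually_const_lt hpos)).mono fun y => eq_true) hp
  · exact hpI (jumpSet_subset_of_isClosed isClosed_Icc (fun y h => h.1) hp)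

namespace IsTransitionSeq

theorem jumpSet_eq (h : IsTransitionSeq L np n N x) (hnp : np ≠ 1) : jumpSet n = x '' Iic N := by
  rw [jumpSet_congr_ae (h.ae_eq.trans (stepIndex_ae_eq h.odd h.strictMono)), jumpSet_ite hnp,
    jumpSet_odd_card_filter_lt, Finset.coe_image, Finset.coe_range]
  exact congrArg (x '' ·) (Set.ext fun i => Nat.lt_succ_iff)

theorem apply_eq_sub (h : IsTransitionSeq L np n N x) (hnp : np ≠ 1)
    (hsymm : ∀ y, n (L - y) = n y) (hj : j ≤ N) : x j = L - x (N - j) := by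
  have hmem : ∀ {p}, p ∈ jumpSet n ↔ ∃ i ≤ N, x i = p := fun {p} => by
    rw [h.jumpSet_eq hnp]; rfl
  have hx : StrictMono fun i : Fin (N + 1) => x i := fun i k hik =>
    h.strictMono (Nat.lt_succ_iff.1 i.2) (Nat.lt_succ_iff.1 k.2) hik
  have hx' : StrictMono fun i : Fin (N + 1) => L - x (N - i) := fun i k hik =>
    sub_lt_sub_left (h.strictMono (Nat.sub_le N k) (Nat.sub_le N i) (by omega)) L
  refine congrFun ((hx.range_inj hx').1 (Subset.antisymm ?_ ?_)) ⟨j, Nat.lt_succ_of_le hj⟩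
  · rintro _ ⟨i, rfl⟩
    obtain ⟨k, hk, hki⟩ := hmem.1
      (const_sub_mem_jumpSet hsymm (hmem.2 ⟨i, Nat.lt_succ_iff.1 i.2, rfl⟩))
    exact ⟨⟨N - k, by omega⟩, by simp [Nat.sub_sub_self hk, hki]⟩
  · rintro _ ⟨i, rfl⟩
    obtain ⟨k, hk, hki⟩ := hmem.1
      (const_sub_mem_jumpSet hsymm (hmem.2 ⟨N - i, Nat.sub_le N i, rfl⟩))
    exact ⟨⟨k, Nat.lt_succ_of_le hk⟩, hki⟩

theorem center_notMem (h : IsTransitionSeq L np n N x) (hnp : np ≠ 1)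
    (hsymm : ∀ y, n (L - y) = n y) (hj : IsInterior N j) :
    L / 2 ∉ Icc (x j) (x (j + 1)) := by
  obtain ⟨-, hjN, hne⟩ := hj
  obtain ⟨k, hk⟩ := h.odd
  rintro ⟨hleft, hright⟩
  obtain hlt | hgt := Nat.lt_or_gt_of_ne hne
  · have hlt : x (j + 1) < x (N - (j + 1)) :=
      h.strictMono hjN.le (Nat.sub_le _ _) (by omega)
    linarith [h.apply_eq_sub hnp hsymm hjN.le]
  · have hlt : x (N - j) < x j := h.strictMono (Nat.sub_le _ _) (show j ≤ N by omega) (by omega)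
    linarith [h.apply_eq_sub hnp hsymm (show j ≤ N by omega)]

theorem apply_eq_zero (h : IsTransitionSeq L np n N x) (hnp : np ≠ 1) (hG : Continuous G)
    (hn : n =ᵐ[volume] bangBang L np G) (hj0 : 0 < j) (hjN : j < N) : G (x j) = 0 := by
  have hjump : x j ∈ jumpSet (bangBang L np G) := by
    rw [← jumpSet_congr_ae hn, h.jumpSet_eq hnp]
    exact mem_image_of_mem x hjN.le
  have hmem := jumpSet_mem_Icc_and_pos_subset hG ((jumpSet_ite hnp).le hjump)
  have h0 : 0 < x j := (h.mem 0 (Nat.zero_le N)).1.trans_lt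
    (h.strictMono (Nat.zero_le N) hjN.le hj0)
  have hL : x j < L := (h.strictMono hjN.le self_mem_Iic hjN).trans_le (h.mem N le_rfl).2
  simpa [h0.ne', hL.ne, h0.le, hL.le] using hmem

end IsTransitionSeq

end Transitions

theorem IsResonancePair.not_ae_eq_one {L : ℝ} {n : ℝ → ℝ} {ω : ℂ} {u : ℝ → ℂ}
    (h : IsResonancePair L n ω u) : ¬n =ᵐ[volume] 1 := by
  refine fun hone => h.nontrivial (funext fun x => ?_)
  rw [h.eq x, integral_eq_zero_of_ae]
  · simp
  · filter_upwards [ae_restrict_of_ae hone] with y hy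
    simp [hy]

end Resonance1D

theorem proposition6p6 (L np ρ : ℝ) (hL : 0 < L) (hnp : 1 < np)
    (n : ℝ → ℝ) (hn : Resonance1D.IsLocalMinimizer L 1 np ρ n)
    (ω : ℂ) (u : ℝ → ℂ) (hu : Resonance1D.IsResonancePair L n ω u)
    (hω : ENNReal.ofReal |ω.im| = Resonance1D.width L ρ n)
    (hωρ : |ω.re| < ρ) (hω0 : 0 < |ω.re|) :
    u 0 ≠ 0 ∧
    (∃ (N : ℕ) (x : ℕ → ℝ), Resonance1D.IsTransitionSeq L np n N x) ∧
    ∀ (N : ℕ) (x : ℕ → ℝ), Resonance1D.IsTransitionSeq L np n N x →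
      ∀ j, Resonance1D.IsInterior N j →
        ∃ m : ℝ, IsLeast ((fun y => ‖u y‖ ^ 2) '' Set.Icc (x j) (x (j + 1))) m ∧
          m / ‖u 0‖ ^ 2 * (1 / 4) * (2 * Real.pi / |ω.re|) ≤ |x (j + 1) - x j| := by
  have hre : ω.re ≠ 0 := abs_pos.1 hω0
  obtain ⟨w, h, hout⟩ := hu.exists_solvesHelmholtz hL.le hn.1
  obtain ⟨a, ha, hfin, hbb⟩ :=
    hn.exists_ae_eq_bangBang hL hnp.le hout h hu.nontrivial hω hωρ hre
  have hG : Continuous fun x => (a * u x ^ 2).im :=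
    Complex.continuous_im.comp (continuous_const.mul (h.continuous.pow 2))
  have hK := Resonance1D.AdmissibleSym.norm_permittivity_le hn.1 hL.le
  refine ⟨hout.left_ne_zero h hK hu.nontrivial, ?_, fun N x hx j hj => ?_⟩
  · exact Resonance1D.exists_isTransitionSeq (fun y hy => hy.1)
      (((Set.toFinite {0, L}).union hfin).subset (Resonance1D.jumpSet_mem_Icc_and_pos_subset hG))
      hbb hu.not_ae_eq_one
  · have hj' : j + 1 < N := hj.2.1
    exact hout.exists_isLeast_le h (Resonance1D.AdmissibleSym.permittivity_reflect hn.1)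
      (Resonance1D.AdmissibleSym.ne_zero hn.1) hK hu.nontrivial hre hL ha
      (hx.strictMono (Set.mem_Iic.2 (by omega)) (Set.mem_Iic.2 hj'.le) (Nat.lt_succ_self j))
      (hx.mem j (by omega)) (hx.mem (j + 1) hj'.le)
      (hx.center_notMem hnp.ne' hn.1.2.2.2 hj)
      (hx.apply_eq_zero hnp.ne' hG hbb hj.1 (by omega))
      (hx.apply_eq_zero hnp.ne' hG hbb (Nat.succ_pos j) hj')
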